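/- Let $X$ be an irreducible Markov chain on a finite set $V$ with transition probabilities $p_{uv}$ and stationary distribution $\pi$, and suppose that $X$ is lazy, i.e. $p_{vv}=1/2$ for all $v\in V$. For $A,B\subset V$ put \[ Q(A,B)=\sum_{a\in A,\,b\in B}\pi(a)p_{ab},\qquad \Phi(A)=\frac{Q(A,A^c)}{\pi(A)\pi(A^c)} . \] Call $A\subset V$ connected if it induces a connected subgraph of the graph on $V$ in which distinct $u,v$ are adjacent when $p_{uv}>0$ or $p_{vu}>0$. For $\theta\in(0,1)$, a $\theta$-bottleneck sequence is a strictly increasing sequence $S_1\subset S_2\subset\dots\subset S_l$ ($l\ge 1$) of subsets of $V$ with $S_1\neq\emptyset$ and $S_l\neq V$ such that $S_j$ and $S_j^c$ are connected for $1\le j\le l$, and $Q(S_{j+1}\setminus S_j,S_j)\ge\theta\,Q(S_j^c,S_j)$ for $1\le j<l$. Let $\mathcal S_\theta(X)$ be the set of all $\theta$-bottleneck sequences. A stopping rule from $v$ to $\pi$ is a randomised stopping time $\tau$ (at each time it decides whether to stop using the history of the chain and extra randomness) with $\mathbb P_v(X_\tau=u)=\pi(u)$ for all $u\in V$. Let \[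 t_{\mathrm{stop}}(X)=\max_{v\in V}\inf\{\mathbb E_v[\tau]:\tau\text{ is a stopping rule from }v\text{ to }\pi\}, \] \[ t_{\mathrm{mix}}(X)=\min\Big\{n\ge 0:\ \max_{v\in V}\max_{A\subset V}|\mathbb P_v(X_n\in A)-\pi(A)|\le \tfrac14\Big\}. \] Theorem. For every $\theta\in(0,1)$ there is a constant $C_\theta\in(0,\infty)$, depending only on $\theta$, such that for every finite irreducible lazy Markov chain $X$ the maximum below exists and \[ t_{\mathrm{stop}}(X)\le\frac{1}{1-\theta}\max_{(S_1,\dots,S_l)\in\mathcal S_\theta(X)}\sum_{j=1}^{l}\frac1{\Phi(S_j)} , \] and, if $X$ is also reversible (i.e. $\pi(x)p_{xy}=\pi(y)p_{yx}$ for all $x,y\in V$), \[ t_{\mathrm{mix}}(X)\le C_\theta\max_{(S_1,\dots,S_l)\in\mathcal S_\theta(X)}\sum_{j=1}^{l}\frac1{\Phi(S_j)} . \] -/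

import Mathlib

open scoped ENNReal

noncomputable section

namespace BottleneckSeq

/-- `P` is the transition matrix of an irreducible Markov chain on `V` that is lazy, in the sense
that it stays where it is with probability exactly `1/2`. -/
structure IsLazyIrreducible {V : Type*} [Fintype V] [DecidableEq V] (P : Matrix V V ℝ) :
    Prop where
  stochastic : P ∈ Matrix.rowStochastic ℝ V
  irreducible : P.IsIrreducible
  lazy : ∀ v, P v v = 1 / 2

/-- `π` is a stationary probability distribution of `P`. For an irreducible stochastic matrix on a
nonempty finite set there is exactly one. -/
structure IsStationary {V : Type*} [Fintype V] (P : Matrix V V ℝ) (π : V → ℝ) : Prop where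
  nonneg : ∀ v, 0 ≤ π v
  sum_eq_one : ∑ v, π v = 1
  invariant : ∀ v, ∑ u, π u * P u v = π v

/-- Reversibility (detailed balance). -/
def IsReversible {V : Type*} (P : Matrix V V ℝ) (π : V → ℝ) : Prop :=
  ∀ x y, π x * P x y = π y * P y x

/-! ### Mixing time -/

/-- Total variation distance `max_{A ⊆ V} |μ(A) - ν(A)|`. -/
def tvDist {V : Type*} [Fintype V] (μ ν : V → ℝ) : ℝ :=
  ⨆ A : Finset V, |∑ v ∈ A, μ v - ∑ v ∈ A, ν v|

/-- The total variation mixing time: the least `n` such that, from every starting state `v`, the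
law `(P ^ n) v` of the chain at time `n` is within `1/4` of `π` (it is `∞` if there is no
such `n`). -/
def tMix {V : Type*} [Fintype V] [DecidableEq V] (P : Matrix V V ℝ) (π : V → ℝ) : ℝ≥0∞ :=
  ⨅ (n : ℕ) (_ : ∀ v, tvDist ((P ^ n) v) π ≤ 1 / 4), (n : ℝ≥0∞)

/-! ### Stopping rules -/

/-- A randomised stopping rule for a chain on `V`: `haltProb n w` is the conditional probability of
stopping at time `n`, given that the rule has not stopped before time `n` and that the trajectory
`(X_0, …, X_n)` observed so far is `w`. -/
structure StoppingRule (V : Type*) where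
  haltProb : (n : ℕ) → (Fin (n + 1) → V) → ℝ
  nonneg : ∀ n w, 0 ≤ haltProb n w
  le_one : ∀ n w, haltProb n w ≤ 1

/-- `ℙ_s(X_0 = w 0, …, X_n = w n)`. -/
def pathProb {V : Type*} [DecidableEq V] (P : Matrix V V ℝ) (s : V) (n : ℕ)
    (w : Fin (n + 1) → V) : ℝ :=
  (if w 0 = s then 1 else 0) * ∏ i : Fin n, P (w i.castSucc) (w i.succ)

namespace StoppingRule

/-- The conditional probability of the event `τ = n` given that the trajectory up to time `n`
is `w`. -/
def stopAt {V : Type*} (τ : StoppingRule V) (n : ℕ) (w : Fin (n + 1) → V) : ℝ :=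
  (∏ i : Fin n, (1 - τ.haltProb i (Fin.take (i + 1) (Nat.succ_le_succ i.isLt.le) w))) * τ.haltProb n w

/-- `ℙ_s(τ = n, X_n = u)`. -/
def probStop {V : Type*} [Fintype V] [DecidableEq V] (P : Matrix V V ℝ) (s : V)
    (τ : StoppingRule V) (n : ℕ) (u : V) : ℝ :=
  ∑ w : Fin (n + 1) → V with w (Fin.last n) = u, pathProb P s n w * τ.stopAt n w

/-- `τ` is a stopping rule from `s` to `π`: `ℙ_s(X_τ = u) = π u` for every `u`. -/
def IsFromTo {V : Type*} [Fintype V] [DecidableEq V] (P : Matrix V V ℝ) (s : V) (π : V → ℝ)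
    (τ : StoppingRule V) : Prop :=
  ∀ u, HasSum (fun n => probStop P s τ n u) (π u)

/-- `ℙ_s(τ = n)`. -/
def probTime {V : Type*} [Fintype V] [DecidableEq V] (P : Matrix V V ℝ) (s : V)
    (τ : StoppingRule V) (n : ℕ) : ℝ≥0∞ :=
  ENNReal.ofReal (∑ u, probStop P s τ n u)

/-- `𝔼_s[τ] = ∑ n, n ℙ_s(τ = n) + ∞ · ℙ_s(τ = ∞)`, where `∞ · 0 = 0`. -/
def expectedTime {V : Type*} [Fintype V] [DecidableEq V] (P : Matrix V V ℝ) (s : V)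
    (τ : StoppingRule V) : ℝ≥0∞ :=
  ∑' n : ℕ, (n : ℝ≥0∞) * probTime P s τ n + ⊤ * (1 - ∑' n : ℕ, probTime P s τ n)

end StoppingRule

/-- `t_stop = max_s inf {𝔼_s[τ] : τ is a stopping rule from s to π}`. -/
def tStop {V : Type*} [Fintype V] [DecidableEq V] (P : Matrix V V ℝ) (π : V → ℝ) : ℝ≥0∞ :=
  ⨆ s : V, ⨅ (τ : StoppingRule V) (_ : τ.IsFromTo P s π), τ.expectedTime P s

/-! ### Bottleneck sequences -/

/-- `Q(A, B) = ℙ_π(X_0 ∈ A, X_1 ∈ B)`. -/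
def flow {V : Type*} (P : Matrix V V ℝ) (π : V → ℝ) (A B : Finset V) : ℝ :=
  ∑ a ∈ A, ∑ b ∈ B, π a * P a b

/-- `Φ(A) = Q(A, Aᶜ) / (π(A) π(Aᶜ))`. -/
def conductance {V : Type*} [Fintype V] [DecidableEq V] (P : Matrix V V ℝ) (π : V → ℝ)
    (A : Finset V) : ℝ :=
  flow P π A Aᶜ / ((∑ a ∈ A, π a) * ∑ a ∈ Aᶜ, π a)

/-- The undirected graph of the chain: distinct `u`, `v` are adjacent iff `0 < P u v` or
`0 < P v u`. -/
def chainGraph {V : Type*} (P : Matrix V V ℝ) : SimpleGraph V :=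
  SimpleGraph.fromRel fun u v => 0 < P u v

/-- The sequence `S 0 ⊂ S 1 ⊂ … ⊂ S k` (of length `l = k + 1`) of subsets of `V` is a
`θ`-bottleneck sequence. -/
structure IsBottleneckSeq {V : Type*} [Fintype V] [DecidableEq V] (P : Matrix V V ℝ)
    (π : V → ℝ) (θ : ℝ) {k : ℕ} (S : Fin (k + 1) → Finset V) : Prop where
  strictMono : StrictMono S
  first_ne : S 0 ≠ ∅
  last_ne : S (Fin.last k) ≠ Finset.univ
  connected : ∀ j, ((chainGraph P).induce (S j : Set V)).Connected
  compl_connected : ∀ j, ((chainGraph P).induce ((S j : Set V)ᶜ)).Connected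
  flow_le : ∀ j : Fin k, θ * flow P π (S j.castSucc)ᶜ (S j.castSucc) ≤
    flow P π (S j.succ \ S j.castSucc) (S j.castSucc)

/-- The values `∑ j, 1 / Φ(S_j)` over all `θ`-bottleneck sequences `S_1 ⊂ … ⊂ S_l`. -/
def bottleneckSums {V : Type*} [Fintype V] [DecidableEq V] (P : Matrix V V ℝ) (π : V → ℝ)
    (θ : ℝ) : Set ℝ :=
  {x | ∃ (k : ℕ) (S : Fin (k + 1) → Finset V),
    IsBottleneckSeq P π θ S ∧ x = ∑ j, 1 / conductance P π (S j)}

end BottleneckSeq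

end

noncomputable section

namespace BottleneckSeq

open Filter Topology Matrix

/-! Let unit mass start at `s` and move by `P`, stopping at each vertex until the amount prescribed
by `π` is reached there. This filling rule is a stopping rule from `s` to `π`, and its expected time
is at most `∑ u, x u`, where `x u` (`exitFreq`) is the expected number of exits from `u`. Some
vertex `z` never overflows, so `x z = 0`.

Put `y = x / π`. Conservation of mass gives `∑ w, π w * y w * P w u = π u * (y u + 1)` for `u ≠ s`.
Hence every vertex except `s` has a neighbour with a larger value of `y`, so complements of
components of sublevel sets avoiding `s` are connected. If `B ∌ s` is the component of `z` in `{y ≤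
r}`, conservation summed over `B` bounds the `Q`-average of `y - r` over the edges entering `B` by
`π(B) / Q(Bᶜ, B)`. By Markov's inequality, raising `r` by `π(B) / ((1 - θ) Q(Bᶜ, B))` brings at
least a proportion `θ` of this flow inside the new component (`IsExitDensity.flow_step`). Iterating
produces a `θ`-bottleneck sequence. Each rise in level, weighted by `π(Bᶜ)`, is exactly `1 / ((1 -
θ) Φ(B))`, and these rises together bound `∑ π y = ∑ x` (`IsExitDensity.exists_bottleneckSeq`).

For mixing, the mass still moving after time `L` is at most `T / (L + 1)`, where `T` bounds `∑ x`,
and the law of the mass already stopped is dominated by `π`. In a lazy reversible chain `P` is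
self-adjoint with `0 ≤ P ≤ 1`, whence `‖Pⁿ⁺¹ f - Pⁿ f‖ ≤ ‖f‖ / (n + 1)` (`wInner_pow_sub_le`).
Running on for a time `N` much larger than `L` therefore makes the random stopping time irrelevant,
and a fixed time of order `T` suffices. -/

/-- The conditional probability that `τ` does not stop before time `n`, given the trajectory. -/
def StoppingRule.survive {V : Type*} (τ : StoppingRule V) (n : ℕ) (w : Fin (n + 1) → V) : ℝ :=
  ∏ i : Fin n, (1 - τ.haltProb i (Fin.take (i + 1) (Nat.succ_le_succ i.isLt.le) w))

lemma survive_snoc {V : Type*} (τ : StoppingRule V) (n : ℕ) (w : Fin (n + 1) → V) (u : V) :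
    τ.survive (n + 1) (Fin.snoc w u : Fin (n + 2) → V) =
      τ.survive n w * (1 - τ.haltProb n w) := by
  have key : ∀ (m : ℕ) (h : m + 1 ≤ n + 1),
      Fin.take (m + 1) (h.trans (Nat.le_succ _)) (Fin.snoc w u : Fin (n + 2) → V) =
        Fin.take (m + 1) h w := by
    intro m h
    funext j
    simp only [Fin.take_apply]
    exact Fin.snoc_castSucc (α := fun _ => V) u w (Fin.castLE h j)
  rw [StoppingRule.survive, Fin.prod_univ_castSucc, StoppingRule.survive]
  congr 1
  · refine Finset.prod_congr rfl fun i _ => ?_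
    simp only [Fin.val_castSucc]
    rw [key i (Nat.succ_le_succ i.isLt.le)]
  · simp only [Fin.val_last]
    rw [key n le_rfl, Fin.take_eq_self]

lemma pathProb_snoc {V : Type*} [DecidableEq V] {P : Matrix V V ℝ} (s : V) (n : ℕ)
    (w : Fin (n + 1) → V) (u : V) :
    pathProb P s (n + 1) (Fin.snoc w u : Fin (n + 2) → V) =
      pathProb P s n w * P (w (Fin.last n)) u := by
  rw [pathProb, pathProb, Fin.prod_univ_castSucc, ← mul_assoc]
  have h0 : (Fin.snoc w u : Fin (n + 2) → V) 0 = w 0 :=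
    Fin.snoc_castSucc (α := fun _ => V) u w 0
  have hc : ∀ i, (Fin.snoc w u : Fin (n + 2) → V) (Fin.castSucc i) = w i :=
    Fin.snoc_castSucc (α := fun _ => V) u w
  have hl : (Fin.snoc w u : Fin (n + 2) → V) (Fin.last (n + 1)) = u :=
    Fin.snoc_last (α := fun _ => V) u w
  simp_rw [h0, ← Fin.castSucc_succ, hc, Fin.succ_last, hl]

section Filling

variable {V : Type*} [Fintype V] [DecidableEq V] {P : Matrix V V ℝ} {π : V → ℝ}

/-! ### The filling rule -/

/-- State of the filling rule from `s` to `π` at time `n`: the mass still moving that is present at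
each vertex at time `n`, and the mass that has stopped at each vertex strictly before time `n`.
At each vertex `u` mass stops until the total `π u` is reached; the excess moves on. -/
def fillState (P : Matrix V V ℝ) (π : V → ℝ) (s : V) : ℕ → (V → ℝ) × (V → ℝ)
  | 0 => (Pi.single s 1, 0)
  | n + 1 =>
    let m := fillState P π s n
    (fun u => ∑ w, max (m.2 w + m.1 w - π w) 0 * P w u, fun u => min (m.2 u + m.1 u) (π u))

/-- The moving mass present at `u` at time `n`. -/
def present (P : Matrix V V ℝ) (π : V → ℝ) (s : V) (n : ℕ) (u : V) : ℝ :=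
  (fillState P π s n).1 u

/-- The mass stopped at `u` before time `n`. -/
def filled (P : Matrix V V ℝ) (π : V → ℝ) (s : V) (n : ℕ) (u : V) : ℝ :=
  (fillState P π s n).2 u

/-- The mass that leaves `u` at time `n`. -/
def exitMass (P : Matrix V V ℝ) (π : V → ℝ) (s : V) (n : ℕ) (u : V) : ℝ :=
  max (filled P π s n u + present P π s n u - π u) 0

/-- The mass that stops at `u` at time `n`. -/
def stopMass (P : Matrix V V ℝ) (π : V → ℝ) (s : V) (n : ℕ) (u : V) : ℝ :=
  present P π s n u - exitMass P π s n u

/-- The total mass that is still moving after time `n`. -/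
def moving (P : Matrix V V ℝ) (π : V → ℝ) (s : V) (n : ℕ) : ℝ :=
  ∑ u, exitMass P π s n u

lemma present_zero (s u : V) : present P π s 0 u = if u = s then 1 else 0 := by
  simp [present, fillState, Pi.single_apply]

lemma filled_zero (s u : V) : filled P π s 0 u = 0 := rfl

lemma present_succ (s : V) (n : ℕ) (u : V) :
    present P π s (n + 1) u = ∑ w, exitMass P π s n w * P w u := rfl

lemma filled_succ (s : V) (n : ℕ) (u : V) :
    filled P π s (n + 1) u = filled P π s n u + stopMass P π s n u := by
  change min (filled P π s n u + present P π s n u) (π u) = _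
  rw [stopMass, exitMass]
  rcases le_total (filled P π s n u + present P π s n u) (π u) with h | h
  · rw [min_eq_left h, max_eq_right (by linarith)]; ring
  · rw [min_eq_right h, max_eq_left (by linarith)]; ring

lemma filled_le (hπ : ∀ v, 0 ≤ π v) (s : V) (n : ℕ) (u : V) : filled P π s n u ≤ π u := by
  cases n with
  | zero => simpa [filled_zero] using hπ u
  | succ n => exact min_le_right _ _

lemma filled_eq_sum (s : V) (n : ℕ) (u : V) :
    filled P π s n u = ∑ k ∈ Finset.range n, stopMass P π s k u := by
  induction n with
  | zero => simp [filled_zero]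
  | succ n ih => rw [filled_succ, ih, Finset.sum_range_succ]

lemma exitMass_nonneg (s : V) (n : ℕ) (u : V) : 0 ≤ exitMass P π s n u := le_max_right _ _

lemma moving_nonneg (s : V) (n : ℕ) : 0 ≤ moving P π s n :=
  Finset.sum_nonneg fun u _ => exitMass_nonneg s n u

lemma present_nonneg (hP : P ∈ rowStochastic ℝ V) (s : V) (n : ℕ) (u : V) :
    0 ≤ present P π s n u := by
  cases n with
  | zero => rw [present_zero]; split_ifs <;> norm_num
  | succ n =>
    rw [present_succ]
    exact Finset.sum_nonneg fun w _ =>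
      mul_nonneg (exitMass_nonneg s n w) (nonneg_of_mem_rowStochastic hP)

lemma exitMass_le_present (hP : P ∈ rowStochastic ℝ V) (hπ : ∀ v, 0 ≤ π v) (s : V) (n : ℕ) (u : V) :
    exitMass P π s n u ≤ present P π s n u :=
  max_le (by linarith [filled_le (P := P) hπ s n u]) (present_nonneg hP s n u)

lemma stopMass_nonneg (hP : P ∈ rowStochastic ℝ V) (hπ : ∀ v, 0 ≤ π v) (s : V) (n : ℕ) (u : V) :
    0 ≤ stopMass P π s n u := sub_nonneg.2 (exitMass_le_present hP hπ s n u)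

lemma filled_mono (hP : P ∈ rowStochastic ℝ V) (hπ : ∀ v, 0 ≤ π v) (s u : V) :
    Monotone fun n => filled P π s n u :=
  monotone_nat_of_le_succ fun n => by
    rw [filled_succ]; linarith [stopMass_nonneg hP hπ s n u]

lemma sum_mul_stochastic (hP : P ∈ rowStochastic ℝ V) (f : V → ℝ) :
    ∑ u, ∑ w, f w * P w u = ∑ w, f w := by
  rw [Finset.sum_comm]
  simp_rw [← Finset.mul_sum, sum_row_of_mem_rowStochastic hP, mul_one]

lemma sum_present_succ (hP : P ∈ rowStochastic ℝ V) (s : V) (n : ℕ) :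
    ∑ u, present P π s (n + 1) u = moving P π s n := by
  simp_rw [present_succ, sum_mul_stochastic hP]; rfl

lemma sum_filled_add_sum_present (hP : P ∈ rowStochastic ℝ V) (s : V) (n : ℕ) :
    ∑ u, filled P π s n u + ∑ u, present P π s n u = 1 := by
  induction n with
  | zero => simp [filled_zero, present_zero]
  | succ n ih =>
    rw [sum_present_succ hP]
    simp_rw [filled_succ, stopMass, moving]
    rw [Finset.sum_add_distrib, Finset.sum_sub_distrib]
    linarith

lemma sum_filled_succ_add_moving (hP : P ∈ rowStochastic ℝ V) (s : V) (n : ℕ) :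
    ∑ u, filled P π s (n + 1) u + moving P π s n = 1 := by
  rw [← sum_present_succ hP, sum_filled_add_sum_present hP]

lemma sum_stopMass_succ (hP : P ∈ rowStochastic ℝ V) (s : V) (n : ℕ) :
    ∑ u, stopMass P π s (n + 1) u = moving P π s n - moving P π s (n + 1) := by
  simp_rw [stopMass]
  rw [Finset.sum_sub_distrib, sum_present_succ hP]; rfl

lemma moving_antitone (hP : P ∈ rowStochastic ℝ V) (hπ : ∀ v, 0 ≤ π v) (s : V) :
    Antitone (moving P π s) :=
  antitone_nat_of_succ_le fun n => by
    have := Finset.sum_nonneg fun u (_ : u ∈ Finset.univ) => stopMass_nonneg hP hπ s (n + 1) u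
    rw [sum_stopMass_succ hP] at this
    linarith

lemma moving_zero_le_one (hP : P ∈ rowStochastic ℝ V) (hπ : ∀ v, 0 ≤ π v) (s : V) :
    moving P π s 0 ≤ 1 := by
  have h : ∑ u, present P π s 0 u = 1 := by simp [present_zero]
  rw [← h]
  exact Finset.sum_le_sum fun u _ => exitMass_le_present hP hπ s 0 u

lemma moving_le_one (hP : P ∈ rowStochastic ℝ V) (hπ : ∀ v, 0 ≤ π v) (s : V) (n : ℕ) :
    moving P π s n ≤ 1 :=
  (moving_antitone hP hπ s n.zero_le).trans (moving_zero_le_one hP hπ s)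

/-- Mass leaves a vertex only as overflow, so the vertex is full from then on. -/
lemma filled_eq_of_exitMass_pos {s u : V} {n : ℕ} (h : 0 < exitMass P π s n u) :
    filled P π s (n + 1) u = π u := by
  have h1 : 0 < filled P π s n u + present P π s n u - π u := by
    by_contra hc
    rw [exitMass, max_eq_right (not_lt.1 hc)] at h
    exact lt_irrefl _ h
  exact min_eq_right (by change π u ≤ filled P π s n u + present P π s n u; linarith)

/-- The filling rule has a halting state. -/
lemma exists_halting (hP : P ∈ rowStochastic ℝ V) (hS : IsStationary P π) (s : V) :
    ∃ z, ∀ n, exitMass P π s n z = 0 := by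
  by_contra! hc
  choose N hN using hc
  have hpos : ∀ z, 0 < exitMass P π s (N z) z := fun z =>
    lt_of_le_of_ne (exitMass_nonneg _ _ _) (hN z).symm
  -- If every vertex overflows at some time, take the one whose chosen overflow time is latest. By
  -- then all vertices are full, the stopped mass is already 1, and nothing is left to overflow.
  obtain ⟨z, -, hz⟩ := Finset.exists_max_image Finset.univ N ⟨s, Finset.mem_univ s⟩
  have hfull : ∀ u, filled P π s (N z + 1) u = π u := fun u =>
    le_antisymm (filled_le hS.nonneg _ _ _) <| by
      rw [← filled_eq_of_exitMass_pos (hpos u)]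
      exact filled_mono hP hS.nonneg s u (Nat.succ_le_succ (hz u (Finset.mem_univ u)))
  have h0 := sum_filled_succ_add_moving (π := π) hP s (N z)
  simp_rw [hfull, hS.sum_eq_one] at h0
  have h1 := Finset.single_le_sum (f := fun u => exitMass P π s (N z) u)
    (fun u _ => exitMass_nonneg s (N z) u) (Finset.mem_univ z)
  have h2 := hpos z
  change _ ≤ moving P π s (N z) at h1
  linarith

/-! ### Positivity of powers of `P` and termination of the filling rule -/

lemma pow_nonneg_apply (hP : P ∈ rowStochastic ℝ V) (n : ℕ) (u v : V) : 0 ≤ (P ^ n) u v :=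
  nonneg_of_mem_rowStochastic (pow_mem hP n)

/-- Stopping only removes mass, so the moving mass is dominated by its evolution without stopping.
-/
lemma exitMass_add_le (hP : P ∈ rowStochastic ℝ V) (hπ : ∀ v, 0 ≤ π v) (s : V) (n k : ℕ) (u : V) :
    exitMass P π s (n + k) u ≤ ∑ w, exitMass P π s n w * (P ^ k) w u := by
  induction k generalizing u with
  | zero => simp [Matrix.one_apply]
  | succ k ih =>
    calc exitMass P π s (n + (k + 1)) u ≤ present P π s (n + k + 1) u :=
          exitMass_le_present hP hπ s _ u
      _ = ∑ w, exitMass P π s (n + k) w * P w u := present_succ _ _ _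
      _ ≤ ∑ w, (∑ x, exitMass P π s n x * (P ^ k) x w) * P w u :=
          Finset.sum_le_sum fun w _ =>
            mul_le_mul_of_nonneg_right (ih w) (nonneg_of_mem_rowStochastic hP)
      _ = ∑ x, exitMass P π s n x * (P ^ (k + 1)) x u := by
          simp_rw [pow_succ, Matrix.mul_apply, Finset.sum_mul, Finset.mul_sum]
          rw [Finset.sum_comm]
          simp_rw [mul_assoc]

lemma IsLazyIrreducible.pow_pos_mono (hP : IsLazyIrreducible P) {k l : ℕ} (hkl : k ≤ l) {u v : V}
    (h : 0 < (P ^ k) u v) : 0 < (P ^ l) u v := by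
  induction l, hkl using Nat.le_induction with
  | base => exact h
  | succ l _ ih =>
    rw [pow_succ, Matrix.mul_apply]
    refine lt_of_lt_of_le ?_ (Finset.single_le_sum (f := fun j => (P ^ l) u j * P j v)
      (fun j _ => mul_nonneg (pow_nonneg_apply hP.stochastic _ _ _)
        (nonneg_of_mem_rowStochastic hP.stochastic)) (Finset.mem_univ v))
    rw [hP.lazy v]; positivity

lemma IsLazyIrreducible.exists_pow_pos (hP : IsLazyIrreducible P) (u v : V) :
    ∃ k, 0 < (P ^ k) u v := by
  obtain ⟨k, -, hk⟩ := (isIrreducible_iff_exists_pow_pos (A := P)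
    (fun i j => nonneg_of_mem_rowStochastic hP.stochastic)).1 hP.irreducible u v
  exact ⟨k, hk⟩

/-- Laziness keeps positive entries positive, so one exponent serves all starting points. -/
lemma IsLazyIrreducible.exists_pow_ge (hP : IsLazyIrreducible P) (z : V) :
    ∃ (K : ℕ) (ε : ℝ), 0 < ε ∧ ∀ u, ε ≤ (P ^ K) u z := by
  choose k hk using fun u => hP.exists_pow_pos u z
  have hpos : ∀ u, 0 < (P ^ (Finset.univ.sup k)) u z := fun u =>
    hP.pow_pos_mono (Finset.le_sup (Finset.mem_univ u)) (hk u)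
  obtain ⟨u, -, hu⟩ := Finset.exists_min_image Finset.univ
    (fun u => (P ^ (Finset.univ.sup k)) u z) ⟨z, Finset.mem_univ z⟩
  exact ⟨_, _, hpos u, fun w => hu w (Finset.mem_univ w)⟩

lemma IsLazyIrreducible.stationary_pos (hP : IsLazyIrreducible P) (hS : IsStationary P π) (u : V) :
    0 < π u := by
  obtain ⟨K, ε, hε, hK⟩ := hP.exists_pow_ge u
  have hinv : ∀ n v, ∑ w, π w * (P ^ n) w v = π v := by
    intro n
    induction n with
    | zero => intro v; simp [Matrix.one_apply]
    | succ n ih =>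
      intro v
      simp_rw [pow_succ, Matrix.mul_apply, Finset.mul_sum]
      rw [Finset.sum_comm]
      simp_rw [← mul_assoc, ← Finset.sum_mul, ih]
      exact hS.invariant v
  rw [← hinv K u]
  calc 0 < ε := hε
    _ = ∑ w, π w * ε := by rw [← Finset.sum_mul, hS.sum_eq_one, one_mul]
    _ ≤ _ := Finset.sum_le_sum fun w _ => mul_le_mul_of_nonneg_left (hK w) (hS.nonneg w)

/-- Nothing ever leaves the halting state `z`. Of the mass moving at time `n`, a fraction at least
`ε` would be at `z` after `K` free steps, so it has stopped by time `n + K`. The `K`-step losses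
telescope to at most `K`, hence the total is at most `K / ε`. -/
lemma summable_moving (hP : IsLazyIrreducible P) (hS : IsStationary P π) (s : V) :
    Summable (moving P π s) := by
  obtain ⟨z, hz⟩ := exists_halting hP.stochastic hS s
  obtain ⟨K, ε, hε, hK⟩ := hP.exists_pow_ge z
  have hdecay : ∀ n, ε * moving P π s n ≤ moving P π s n - moving P π s (n + K) := by
    intro n
    have h1 : moving P π s (n + K) ≤
        moving P π s n - ∑ w, exitMass P π s n w * (P ^ K) w z := by
      have h := sum_mul_stochastic (pow_mem hP.stochastic K) (exitMass P π s n)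
      rw [← Finset.sum_erase_add _ _ (Finset.mem_univ z)] at h
      have h' : moving P π s (n + K) = ∑ u ∈ Finset.univ.erase z, exitMass P π s (n + K) u := by
        rw [moving, ← Finset.sum_erase_add _ _ (Finset.mem_univ z), hz (n + K), add_zero]
      change _ = moving P π s n at h
      rw [← h, h', add_sub_cancel_right]
      exact Finset.sum_le_sum fun u _ => exitMass_add_le hP.stochastic hS.nonneg s n K u
    have h2 : ε * moving P π s n ≤ ∑ w, exitMass P π s n w * (P ^ K) w z := by
      rw [moving, Finset.mul_sum]
      refine Finset.sum_le_sum fun w _ => ?_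
      rw [mul_comm]
      exact mul_le_mul_of_nonneg_left (hK w) (exitMass_nonneg s n w)
    linarith
  have htel : ∀ N k : ℕ, ∑ n ∈ Finset.range N, (moving P π s n - moving P π s (n + k)) ≤ k := by
    intro N k
    induction k with
    | zero => simp
    | succ k ih =>
      have h3 : ∑ n ∈ Finset.range N, (moving P π s (n + k) - moving P π s (n + 1 + k)) ≤ 1 := by
        rw [Finset.sum_range_sub' (fun n => moving P π s (n + k))]
        linarith [moving_le_one hP.stochastic hS.nonneg s (0 + k),
          moving_nonneg (P := P) (π := π) s (N + k)]
      have h4 := add_le_add ih h3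
      rw [← Finset.sum_add_distrib] at h4
      push_cast
      refine le_trans (le_of_eq (Finset.sum_congr rfl fun n _ => ?_)) h4
      rw [show n + (k + 1) = n + 1 + k by ring]; ring
  refine summable_of_sum_range_le (c := K / ε) (moving_nonneg s) fun N => ?_
  rw [le_div_iff₀ hε, mul_comm, Finset.mul_sum]
  exact (Finset.sum_le_sum fun n _ => hdecay n).trans (htel N K)

/-- Under the filling rule the law of the stopping place is `π`. -/
lemma hasSum_stopMass (hP : IsLazyIrreducible P) (hS : IsStationary P π) (s u : V) :
    HasSum (fun n => stopMass P π s n u) (π u) := by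
  rw [hasSum_iff_tendsto_nat_of_nonneg (fun n => stopMass_nonneg hP.stochastic hS.nonneg s n u)]
  simp_rw [← filled_eq_sum]
  rw [← tendsto_add_atTop_iff_nat 1]
  have h := (tendsto_const_nhds (x := π u)).sub (summable_moving hP hS s).tendsto_atTop_zero
  rw [sub_zero] at h
  refine tendsto_of_tendsto_of_tendsto_of_le_of_le h tendsto_const_nhds (fun n => ?_)
    fun n => filled_le hS.nonneg s (n + 1) u
  have h1 := sum_filled_succ_add_moving (π := π) hP.stochastic s n
  -- The total deficit from `π` equals the mass still moving, which tends to zero.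
  have h2 : π u - filled P π s (n + 1) u ≤ ∑ w, (π w - filled P π s (n + 1) w) :=
    Finset.single_le_sum (f := fun w => π w - filled P π s (n + 1) w)
      (fun w _ => sub_nonneg.2 (filled_le hS.nonneg s (n + 1) w)) (Finset.mem_univ u)
  rw [Finset.sum_sub_distrib, hS.sum_eq_one] at h2
  simp only
  linarith

/-- The expected number of exits from `u` under the filling rule. -/
def exitFreq (P : Matrix V V ℝ) (π : V → ℝ) (s u : V) : ℝ := ∑' n, exitMass P π s n u

lemma exitFreq_nonneg (s u : V) : 0 ≤ exitFreq P π s u :=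
  tsum_nonneg fun n => exitMass_nonneg s n u

lemma hasSum_exitMass (hP : IsLazyIrreducible P) (hS : IsStationary P π) (s u : V) :
    HasSum (fun n => exitMass P π s n u) (exitFreq P π s u) :=
  (Summable.of_nonneg_of_le (fun n => exitMass_nonneg s n u)
    (fun n => Finset.single_le_sum (f := fun u => exitMass P π s n u)
      (fun u _ => exitMass_nonneg s n u) (Finset.mem_univ u)) (summable_moving hP hS s)).hasSum

lemma hasSum_moving (hP : IsLazyIrreducible P) (hS : IsStationary P π) (s : V) :
    HasSum (moving P π s) (∑ u, exitFreq P π s u) :=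
  hasSum_sum fun u _ => hasSum_exitMass hP hS s u

/-- Both sides are the expected number of times that moving mass is present at `u`: arrivals plus
the initial mass, and exits plus stops. -/
lemma exitFreq_conservation (hP : IsLazyIrreducible P) (hS : IsStationary P π) (s u : V) :
    ∑ w, exitFreq P π s w * P w u + (if u = s then 1 else 0) = exitFreq P π s u + π u := by
  have h1 : HasSum (fun n => present P π s (n + 1) u) (∑ w, exitFreq P π s w * P w u) :=
    hasSum_sum fun w _ => (hasSum_exitMass hP hS s w).mul_right _
  have h2 := (hasSum_nat_add_iff (f := fun n => present P π s n u) 1).1 h1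
  have h3 := (hasSum_exitMass hP hS s u).add (hasSum_stopMass hP hS s u)
  simp only [stopMass, add_sub_cancel] at h3
  simpa [present_zero] using h2.unique h3

lemma exists_exitFreq_eq_zero (hP : IsLazyIrreducible P) (hS : IsStationary P π) (s : V) :
    ∃ z, exitFreq P π s z = 0 := by
  obtain ⟨z, hz⟩ := exists_halting hP.stochastic hS s
  exact ⟨z, by simp [exitFreq, hz]⟩

/-! ### The filling rule as a randomised stopping rule -/

/-- The filling rule from `s` to `π`. -/
def fillingRule (hP : P ∈ rowStochastic ℝ V) (hπ : ∀ v, 0 ≤ π v) (s : V) : StoppingRule V where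
  haltProb n w := stopMass P π s n (w (Fin.last n)) / present P π s n (w (Fin.last n))
  nonneg _ _ := div_nonneg (stopMass_nonneg hP hπ _ _ _) (present_nonneg hP _ _ _)
  le_one _ _ := div_le_one_of_le₀
    (sub_le_self _ (exitMass_nonneg _ _ _)) (present_nonneg hP _ _ _)

lemma sum_snoc_filter (n : ℕ) (f : (Fin (n + 2) → V) → ℝ) (u : V) :
    ∑ w : Fin (n + 2) → V with w (Fin.last (n + 1)) = u, f w =
      ∑ w : Fin (n + 1) → V, f (Fin.snoc w u : Fin (n + 2) → V) := by
  symm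
  refine Finset.sum_bij (fun w _ => (Fin.snoc w u : Fin (n + 2) → V)) ?_ ?_ ?_ ?_
  · intro w _
    simp
  · intro w _ w' _ h
    funext i
    have := congrFun h (Fin.castSucc i)
    simpa using this
  · intro w hw
    refine ⟨Fin.init w, Finset.mem_univ _, ?_⟩
    rw [← (Finset.mem_filter.1 hw).2]
    exact Fin.snoc_init_self w
  · intro w _; rfl

lemma sum_survive_fillingRule (hP : P ∈ rowStochastic ℝ V) (hπ : ∀ v, 0 ≤ π v) (s : V) (n : ℕ)
    (u : V) :
    ∑ w : Fin (n + 1) → V with w (Fin.last n) = u,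
      pathProb P s n w * (fillingRule hP hπ s).survive n w = present P π s n u := by
  induction n generalizing u with
  | zero =>
    rw [Finset.sum_filter, ← (Equiv.funUnique (Fin 1) V).symm.sum_comp]
    simp [pathProb, StoppingRule.survive, present_zero, Equiv.funUnique]
  | succ n ih =>
    rw [sum_snoc_filter, present_succ]
    simp_rw [survive_snoc, pathProb_snoc]
    rw [← Finset.sum_fiberwise (s := Finset.univ) (g := fun w : Fin (n + 1) → V => w (Fin.last n))]
    refine Finset.sum_congr rfl fun x _ => ?_
    have h1 : exitMass P π s n x =
        present P π s n x * (1 - stopMass P π s n x / present P π s n x) := by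
      -- The halting quotient is `0` by convention where no mass is present; this is harmless
      -- because the stopped and exiting masses vanish too.
      by_cases h : present P π s n x = 0
      · rw [h, zero_mul]
        exact le_antisymm (h ▸ exitMass_le_present hP hπ s n x) (exitMass_nonneg _ _ _)
      · rw [stopMass]; field_simp; ring
    rw [h1, ← ih x, Finset.sum_mul, Finset.sum_mul]
    refine Finset.sum_congr rfl fun w hw => ?_
    have hw' := (Finset.mem_filter.1 hw).2
    rw [ih x, ← hw']
    simp only [fillingRule]
    ring

lemma probStop_fillingRule (hP : P ∈ rowStochastic ℝ V) (hπ : ∀ v, 0 ≤ π v) (s : V) (n : ℕ)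
    (u : V) :
    StoppingRule.probStop P s (fillingRule hP hπ s) n u = stopMass P π s n u := by
  have h1 : stopMass P π s n u =
      present P π s n u * (stopMass P π s n u / present P π s n u) := by
    by_cases h : present P π s n u = 0
    · rw [h, zero_mul]
      exact le_antisymm (h ▸ sub_le_self _ (exitMass_nonneg _ _ _)) (stopMass_nonneg hP hπ _ _ _)
    · field_simp
  rw [h1, ← sum_survive_fillingRule hP hπ s n u, Finset.sum_mul, StoppingRule.probStop]
  refine Finset.sum_congr rfl fun w hw => ?_
  have hw' := (Finset.mem_filter.1 hw).2
  rw [sum_survive_fillingRule hP hπ s n u, mul_assoc, ← hw']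
  rfl

lemma fillingRule_isFromTo (hP : IsLazyIrreducible P) (hS : IsStationary P π) (s : V) :
    (fillingRule hP.stochastic hS.nonneg s).IsFromTo P s π := fun u => by
  simp_rw [probStop_fillingRule]
  exact hasSum_stopMass hP hS s u

lemma expectedTime_fillingRule_le (hP : IsLazyIrreducible P) (hS : IsStationary P π) (s : V) :
    (fillingRule hP.stochastic hS.nonneg s).expectedTime P s ≤
      ENNReal.ofReal (∑ u, exitFreq P π s u) := by
  have hnn : ∀ n, 0 ≤ ∑ u, stopMass P π s n u := fun n =>
    Finset.sum_nonneg fun u _ => stopMass_nonneg hP.stochastic hS.nonneg s n u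
  have hsum : HasSum (fun n => ∑ u, stopMass P π s n u) 1 := by
    rw [← hS.sum_eq_one]
    exact hasSum_sum fun u _ => hasSum_stopMass hP hS s u
  have hone : ∑' n, ENNReal.ofReal (∑ u, stopMass P π s n u) = 1 := by
    rw [← ENNReal.ofReal_tsum_of_nonneg hnn hsum.summable, hsum.tsum_eq, ENNReal.ofReal_one]
  simp_rw [StoppingRule.expectedTime, StoppingRule.probTime, probStop_fillingRule]
  rw [hone, tsub_self, mul_zero, add_zero]
  refine ENNReal.tsum_le_of_sum_range_le fun N => ?_
  -- Summation by parts: `moving n` is the probability that the rule has not stopped by time `n`, so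
  -- this is the truncated tail formula for the expectation.
  have hN : ∀ N : ℕ, ∑ n ∈ Finset.range (N + 1), (n : ℝ) * ∑ u, stopMass P π s n u =
      ∑ n ∈ Finset.range N, moving P π s n - N * moving P π s N := by
    intro N
    induction N with
    | zero => simp
    | succ N ih =>
      rw [Finset.sum_range_succ, ih, sum_stopMass_succ hP.stochastic, Finset.sum_range_succ]
      push_cast; ring
  calc ∑ n ∈ Finset.range N, (n : ℝ≥0∞) * ENNReal.ofReal (∑ u, stopMass P π s n u)
      = ∑ n ∈ Finset.range N, ENNReal.ofReal (n * ∑ u, stopMass P π s n u) :=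
        Finset.sum_congr rfl fun n _ => by
          rw [ENNReal.ofReal_mul (Nat.cast_nonneg n), ENNReal.ofReal_natCast]
    _ = ENNReal.ofReal (∑ n ∈ Finset.range N, n * ∑ u, stopMass P π s n u) :=
        (ENNReal.ofReal_sum_of_nonneg fun n _ => mul_nonneg (Nat.cast_nonneg n) (hnn n)).symm
    _ ≤ _ := ENNReal.ofReal_le_ofReal <| by
        refine (Finset.sum_le_sum_of_subset_of_nonneg (Finset.range_mono N.le_succ)
          fun n _ _ => mul_nonneg (Nat.cast_nonneg n) (hnn n)).trans ?_
        rw [hN N]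
        have h1 := (hasSum_moving hP hS s).summable.sum_le_tsum (Finset.range N)
          fun n _ => moving_nonneg s n
        rw [(hasSum_moving hP hS s).tsum_eq] at h1
        have h2 : 0 ≤ N * moving P π s N := mul_nonneg (Nat.cast_nonneg N) (moving_nonneg s N)
        linarith

lemma tStop_le (hP : IsLazyIrreducible P) (hS : IsStationary P π) {T : ℝ}
    (hT : ∀ s, ∑ u, exitFreq P π s u ≤ T) : tStop P π ≤ ENNReal.ofReal T :=
  iSup_le fun s => (iInf₂_le _ (fillingRule_isFromTo hP hS s)).trans <|
    (expectedTime_fillingRule_le hP hS s).trans (ENNReal.ofReal_le_ofReal (hT s))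

end Filling

section Sublevel

/-! ### Connected components of sublevel sets -/

lemma connected_induce_of_reflTransGen {V : Type*} {G : SimpleGraph V} {S : Set V} {x : V}
    (hx : x ∈ S)
    (h : ∀ u ∈ S, Relation.ReflTransGen (fun a b => G.Adj a b ∧ a ∈ S ∧ b ∈ S) x u) :
    (G.induce S).Connected := by
  have key : ∀ u, Relation.ReflTransGen (fun a b => G.Adj a b ∧ a ∈ S ∧ b ∈ S) x u →
      ∀ hu : u ∈ S, (G.induce S).Reachable ⟨x, hx⟩ ⟨u, hu⟩ := by
    intro u hu
    induction hu with
    | refl => intro _; exact SimpleGraph.Reachable.refl _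
    | @tail b c _ hbc ih =>
      intro hc
      refine (ih hbc.2.1).trans (SimpleGraph.Adj.reachable ?_)
      exact hbc.1
  refine (SimpleGraph.connected_iff_exists_forall_reachable _).2 ⟨⟨x, hx⟩, ?_⟩
  rintro ⟨u, hu⟩
  exact key u (h u hu) hu

lemma chainGraph_adj {V : Type*} {P : Matrix V V ℝ} {a b : V}
    (hab : a ≠ b) (h : 0 < P a b) : (chainGraph P).Adj a b := by
  simp [chainGraph, SimpleGraph.fromRel_adj, hab, h]

variable {V : Type*} [Fintype V]

open Classical in
/-- The vertices that can be reached from `z` through vertices at which `y ≤ r`. -/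
def sublevelComp (P : Matrix V V ℝ) (y : V → ℝ) (z : V) (r : ℝ) : Finset V :=
  {u | Relation.ReflTransGen (fun a b => (chainGraph P).Adj a b ∧ y b ≤ r) z u}

variable {P : Matrix V V ℝ} {y : V → ℝ} {z : V} {r r' : ℝ}

lemma mem_sublevelComp {u : V} : u ∈ sublevelComp P y z r ↔
    Relation.ReflTransGen (fun a b => (chainGraph P).Adj a b ∧ y b ≤ r) z u := by
  simp [sublevelComp]

lemma self_mem_sublevelComp : z ∈ sublevelComp P y z r :=
  mem_sublevelComp.2 Relation.ReflTransGen.refl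

lemma sublevelComp_mono (h : r ≤ r') : sublevelComp P y z r ⊆ sublevelComp P y z r' :=
  fun _ hu => mem_sublevelComp.2 <|
    Relation.ReflTransGen.mono (fun _ _ hab => ⟨hab.1, hab.2.trans h⟩) _ _
      (mem_sublevelComp.1 hu)

/-- The base point `z` lies in its component whatever its value, so its own bound has to be assumed.
-/
lemma le_of_mem_sublevelComp (hz : y z ≤ r) {u : V} (hu : u ∈ sublevelComp P y z r) : y u ≤ r := by
  rcases (Relation.ReflTransGen.cases_tail_iff _ _ _).1 (mem_sublevelComp.1 hu) with h | ⟨b, -, h⟩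
  · rwa [h]
  · exact h.2

lemma mem_sublevelComp_of_adj {a b : V} (hb : b ∈ sublevelComp P y z r)
    (h : (chainGraph P).Adj b a) (ha : y a ≤ r) : a ∈ sublevelComp P y z r :=
  mem_sublevelComp.2 ((mem_sublevelComp.1 hb).tail ⟨h, ha⟩)

lemma lt_of_adj_sublevelComp {a b : V} (hb : b ∈ sublevelComp P y z r)
    (h : (chainGraph P).Adj b a) (ha : a ∉ sublevelComp P y z r) : r < y a := by
  by_contra hc
  exact ha (mem_sublevelComp_of_adj hb h (not_lt.1 hc))

lemma sublevelComp_connected :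
    ((chainGraph P).induce (sublevelComp P y z r : Set V)).Connected := by
  refine connected_induce_of_reflTransGen (x := z) (Finset.mem_coe.2 self_mem_sublevelComp) ?_
  intro u hu
  have hu' := mem_sublevelComp.1 (Finset.mem_coe.1 hu)
  clear hu
  induction hu' with
  | refl => exact Relation.ReflTransGen.refl
  | @tail b c hb hbc ih =>
    exact ih.tail ⟨hbc.1, Finset.mem_coe.2 (mem_sublevelComp.2 hb),
      Finset.mem_coe.2 (mem_sublevelComp.2 (hb.tail hbc))⟩

/-- Assume that every vertex other than `s` has a neighbour with a larger value of `y`. Then the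
complement of a component of a sublevel set that does not contain `s` is connected. -/
lemma sublevelComp_compl_connected {s : V} (hz : y z ≤ r)
    (hup : ∀ u, u ≠ s → ∃ w, (chainGraph P).Adj u w ∧ y u < y w)
    (hs : s ∉ sublevelComp P y z r) :
    ((chainGraph P).induce ((sublevelComp P y z r : Set V)ᶜ)).Connected := by
  refine connected_induce_of_reflTransGen (x := s) (by simpa using hs) ?_
  -- Climb from `u` through neighbours with larger `y` until `s` is reached. The climb cannot enter
  -- the component: a vertex outside adjacent to it has value above `r`, while values inside are at
  -- most `r`.
  have wf : WellFounded fun a b : V => y b < y a :=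
    have : IsTrans V fun a b => y b < y a := ⟨fun _ _ _ h1 h2 => lt_trans h2 h1⟩
    have : Std.Irrefl fun a b : V => y b < y a := ⟨fun _ => lt_irrefl _⟩
    Finite.wellFounded_of_trans_of_irrefl _
  intro u
  induction u using wf.induction with
  | _ u ih =>
    intro hu
    by_cases hus : u = s
    · rw [hus]
    obtain ⟨w, huw, hyw⟩ := hup u hus
    have hw : w ∉ sublevelComp P y z r := fun hw => by
      have h1 := lt_of_adj_sublevelComp hw huw.symm (by simpa using hu)
      linarith [le_of_mem_sublevelComp hz hw]
    have hw' : w ∈ ((sublevelComp P y z r : Set V)ᶜ) := by simpa using hw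
    exact (ih w hyw hw').tail ⟨huw.symm, hw', hu⟩

end Sublevel

/-! ### Flow into sublevel components and the bottleneck recursion -/

section Flow

variable {V : Type*} [Fintype V] [DecidableEq V] {P : Matrix V V ℝ} {π : V → ℝ} {y : V → ℝ}

lemma flow_compl_comm (hP : P ∈ rowStochastic ℝ V) (hS : IsStationary P π) (A : Finset V) :
    flow P π Aᶜ A = flow P π A Aᶜ := by
  have h1 : flow P π A Aᶜ + flow P π A A = ∑ a ∈ A, π a := by
    rw [flow, flow, ← Finset.sum_add_distrib]
    refine Finset.sum_congr rfl fun a _ => ?_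
    rw [Finset.sum_compl_add_sum, ← Finset.mul_sum, sum_row_of_mem_rowStochastic hP, mul_one]
  have h2 : flow P π Aᶜ A + flow P π A A = ∑ a ∈ A, π a := by
    rw [flow, flow, Finset.sum_compl_add_sum, Finset.sum_comm]
    exact Finset.sum_congr rfl fun a _ => hS.invariant a
  linarith

lemma flow_nonneg (hP : P ∈ rowStochastic ℝ V) (hπ : ∀ v, 0 ≤ π v) (A B : Finset V) :
    0 ≤ flow P π A B :=
  Finset.sum_nonneg fun a _ => Finset.sum_nonneg fun _ _ =>
    mul_nonneg (hπ a) (nonneg_of_mem_rowStochastic hP)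

/-- Without flow from `Aᶜ` to `A`, no power of `P` could lead from `v` to `u`, contrary to
irreducibility. -/
lemma flow_compl_pos (hP : IsLazyIrreducible P) (hS : IsStationary P π) {A : Finset V} {u v : V}
    (hu : u ∈ A) (hv : v ∉ A) : 0 < flow P π Aᶜ A := by
  by_contra hc
  have h0 := le_antisymm (not_lt.1 hc) (flow_nonneg hP.stochastic hS.nonneg _ _)
  have hcross : ∀ a ∉ A, ∀ b ∈ A, P a b = 0 := by
    intro a ha b hb
    rw [flow, Finset.sum_eq_zero_iff_of_nonneg fun a _ => Finset.sum_nonneg fun _ _ =>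
      mul_nonneg (hS.nonneg a) (nonneg_of_mem_rowStochastic hP.stochastic)] at h0
    have h1 := h0 a (Finset.mem_compl.2 ha)
    rw [Finset.sum_eq_zero_iff_of_nonneg fun _ _ =>
      mul_nonneg (hS.nonneg a) (nonneg_of_mem_rowStochastic hP.stochastic)] at h1
    exact (mul_eq_zero.1 (h1 b hb)).resolve_left (hP.stationary_pos hS a).ne'
  have hpow : ∀ k, ∀ a ∉ A, ∀ b ∈ A, (P ^ k) a b = 0 := by
    intro k
    induction k with
    | zero =>
      intro a ha b hb
      rw [pow_zero, Matrix.one_apply_ne]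
      rintro rfl
      exact ha hb
    | succ k ih =>
      intro a ha b hb
      rw [pow_succ, Matrix.mul_apply]
      refine Finset.sum_eq_zero fun w _ => ?_
      by_cases hw : w ∈ A
      · rw [ih a ha w hw, zero_mul]
      · rw [hcross w hw b hb, mul_zero]
  obtain ⟨k, hk⟩ := hP.exists_pow_pos v u
  exact hk.ne' (hpow k v hv u hu)

/-- `y` is the density, with respect to `π`, of the exit frequencies of a stopping rule from `s`
to `π`: the flow through each vertex is conserved. -/
def IsExitDensity (P : Matrix V V ℝ) (π : V → ℝ) (s : V) (y : V → ℝ) : Prop :=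
  ∀ u, ∑ w, π w * y w * P w u + (if u = s then 1 else 0) = π u * y u + π u

/-- The weights `π w * P w u / π u` are the transition probabilities out of `u` of the time-reversed
chain. The corresponding average of `y` is `y u + 1`, so some value exceeds `y u`. -/
lemma IsExitDensity.exists_adj_lt (hP : IsLazyIrreducible P) (hS : IsStationary P π) {s : V}
    (hy : IsExitDensity P π s y) (u : V) (hu : u ≠ s) :
    ∃ w, (chainGraph P).Adj u w ∧ y u < y w := by
  by_contra! hc
  have h1 := hy u
  rw [if_neg hu, add_zero] at h1
  have h2 : ∑ w, π w * y w * P w u ≤ ∑ w, π w * P w u * y u := by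
    refine Finset.sum_le_sum fun w _ => ?_
    rw [mul_assoc, mul_assoc]
    refine mul_le_mul_of_nonneg_left ?_ (hS.nonneg w)
    rw [mul_comm]
    rcases (nonneg_of_mem_rowStochastic hP.stochastic : 0 ≤ P w u).eq_or_lt with h0 | h0
    · simp [← h0]
    · refine mul_le_mul_of_nonneg_left ?_ h0.le
      by_cases hwu : w = u
      · rw [hwu]
      · exact hc w (chainGraph_adj hwu h0).symm
  rw [← Finset.sum_mul, hS.invariant, h1] at h2
  linarith [hP.stationary_pos hS u]

/-- At every level `r`, the mean excess of `y` over `r`, over the boundary of a set on which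
`y ≤ r`, is bounded by the stationary measure of the set. -/
lemma IsExitDensity.sum_excess_le (hP : P ∈ rowStochastic ℝ V) (hS : IsStationary P π) {s : V}
    (hy : IsExitDensity P π s y) {B : Finset V} (hsB : s ∉ B) {r : ℝ} (hr : ∀ b ∈ B, y b ≤ r) :
    ∑ a ∈ Bᶜ, ∑ b ∈ B, (y a - r) * (π a * P a b) ≤ ∑ b ∈ B, π b := by
  -- Sum conservation over `B`: since `s ∉ B`, inflow minus outflow across the boundary is `π(B)`.
  -- The outflow is at most `r Q(B, Bᶜ) = r Q(Bᶜ, B)`.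
  have h1 : ∑ b ∈ B, ∑ w, π w * y w * P w b = ∑ b ∈ B, π b * y b + ∑ b ∈ B, π b := by
    rw [← Finset.sum_add_distrib]
    refine Finset.sum_congr rfl fun b hb => ?_
    rw [← hy b, if_neg (fun h : b = s => hsB (h ▸ hb)), add_zero]
  rw [Finset.sum_comm, ← Finset.sum_compl_add_sum B] at h1
  have h2 : ∑ b ∈ B, π b * y b =
      ∑ w ∈ B, ∑ b ∈ B, π w * y w * P w b + ∑ w ∈ B, ∑ b ∈ Bᶜ, π w * y w * P w b := by
    rw [← Finset.sum_add_distrib]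
    refine Finset.sum_congr rfl fun w _ => ?_
    rw [Finset.sum_add_sum_compl, ← Finset.mul_sum, sum_row_of_mem_rowStochastic hP, mul_one]
  have h3 : ∑ w ∈ B, ∑ b ∈ Bᶜ, π w * y w * P w b ≤ r * flow P π B Bᶜ := by
    rw [flow, Finset.mul_sum]
    refine Finset.sum_le_sum fun w hw => ?_
    rw [Finset.mul_sum]
    refine Finset.sum_le_sum fun b _ => ?_
    have := mul_le_mul_of_nonneg_right (hr w hw)
      (mul_nonneg (hS.nonneg w) (nonneg_of_mem_rowStochastic hP : 0 ≤ P w b))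
    linarith
  have h4 : ∑ a ∈ Bᶜ, ∑ b ∈ B, (y a - r) * (π a * P a b) =
      ∑ w ∈ Bᶜ, ∑ b ∈ B, π w * y w * P w b - r * flow P π Bᶜ B := by
    rw [flow, Finset.mul_sum, ← Finset.sum_sub_distrib]
    refine Finset.sum_congr rfl fun w _ => ?_
    rw [Finset.mul_sum, ← Finset.sum_sub_distrib]
    exact Finset.sum_congr rfl fun b _ => by ring
  rw [h4, flow_compl_comm hP hS]
  linarith

/-- A Markov inequality: raising the level from `r` to `r + π(B) / ((1 - θ) Q)` absorbs a
proportion `θ` of the flow `Q` into the component `B` of the sublevel set. -/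
lemma IsExitDensity.flow_step (hP : IsLazyIrreducible P) (hS : IsStationary P π) {s z : V}
    (hy : IsExitDensity P π s y) {r θ : ℝ} (hθ : θ < 1) (hz : y z ≤ r)
    (hs : s ∉ sublevelComp P y z r) {r' : ℝ}
    (hr' : r' = r + (∑ b ∈ sublevelComp P y z r, π b) /
      ((1 - θ) * flow P π (sublevelComp P y z r)ᶜ (sublevelComp P y z r))) :
    θ * flow P π (sublevelComp P y z r)ᶜ (sublevelComp P y z r) ≤
      flow P π (sublevelComp P y z r' \ sublevelComp P y z r) (sublevelComp P y z r) := by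
  set B := sublevelComp P y z r with hB
  set B' := sublevelComp P y z r' with hB'
  set q := flow P π Bᶜ B with hq
  have hzB : z ∈ B := self_mem_sublevelComp
  have hq0 : 0 < q := flow_compl_pos hP hS hzB hs
  have hπB : 0 < ∑ b ∈ B, π b :=
    Finset.sum_pos (fun b _ => hP.stationary_pos hS b) ⟨z, hzB⟩
  have hθ' : 0 < 1 - θ := by linarith
  have hrr : r < r' := by rw [hr']; linarith [div_pos hπB (mul_pos hθ' hq0)]
  have hBB : B ⊆ B' := sublevelComp_mono hrr.le
  have hsplit : flow P π (B' \ B) B + flow P π B'ᶜ B = q := by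
    rw [hq, flow, flow, flow, ← Finset.sum_union]
    · refine Finset.sum_congr ?_ fun _ _ => rfl
      ext u
      simp only [Finset.mem_union, Finset.mem_sdiff, Finset.mem_compl]
      constructor
      · rintro (h | h)
        · exact h.2
        · exact fun hu => h (hBB hu)
      · intro h
        by_cases hu : u ∈ B'
        · exact Or.inl ⟨hu, h⟩
        · exact Or.inr hu
    · exact Finset.disjoint_left.2 fun u h1 h2 =>
        Finset.mem_compl.1 h2 (Finset.mem_sdiff.1 h1).1
  have hnn : ∀ a b, 0 ≤ π a * P a b := fun a b =>
    mul_nonneg (hS.nonneg a) (nonneg_of_mem_rowStochastic hP.stochastic)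
  have hstep : ∀ {t : ℝ} {a b : V}, a ∉ sublevelComp P y z t → b ∈ sublevelComp P y z t →
      t * (π a * P a b) ≤ y a * (π a * P a b) := by
    intro t a b ha hb
    rcases (nonneg_of_mem_rowStochastic hP.stochastic : 0 ≤ P a b).eq_or_lt with h0 | h0
    · simp [← h0]
    · refine mul_le_mul_of_nonneg_right (lt_of_adj_sublevelComp hb ?_ ha).le (hnn a b)
      exact (chainGraph_adj (fun h : a = b => ha (h ▸ hb)) h0).symm
  -- Edges into `B` from outside `B'` start where `y > r'`, and all other edges entering `B` have
  -- nonnegative excess over `r`.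
  have hmarkov : (r' - r) * flow P π B'ᶜ B ≤ ∑ b ∈ B, π b := by
    refine le_trans ?_ (hy.sum_excess_le hP.stochastic hS hs
      fun b hb => le_of_mem_sublevelComp hz hb)
    calc (r' - r) * flow P π B'ᶜ B
        = ∑ a ∈ B'ᶜ, ∑ b ∈ B, (r' - r) * (π a * P a b) := by
          simp_rw [flow, Finset.mul_sum]
      _ ≤ ∑ a ∈ B'ᶜ, ∑ b ∈ B, (y a - r) * (π a * P a b) :=
          Finset.sum_le_sum fun a ha => Finset.sum_le_sum fun b hb => by
            have := hstep (Finset.mem_compl.1 ha) (hBB hb)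
            linarith
      _ ≤ _ := by
          refine Finset.sum_le_sum_of_subset_of_nonneg (Finset.compl_subset_compl.2 hBB)
            fun a ha _ => Finset.sum_nonneg fun b hb => ?_
          have := hstep (Finset.mem_compl.1 ha) hb
          linarith
  have h5 : r' - r = (∑ b ∈ B, π b) / ((1 - θ) * q) := by rw [hr']; ring
  rw [h5, div_mul_eq_mul_div, div_le_iff₀ (mul_pos hθ' hq0)] at hmarkov
  have h6 := le_of_mul_le_mul_left hmarkov hπB
  linarith

/-- The main recursion: the components of the sublevel sets of `y` contain a `θ`-bottleneck
sequence which bounds the mean excess of `y`. -/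
lemma IsExitDensity.exists_bottleneckSeq (hP : IsLazyIrreducible P) (hS : IsStationary P π)
    {s z : V} (hy : IsExitDensity P π s y) {θ : ℝ} (hθ0 : 0 < θ) (hθ1 : θ < 1) (r : ℝ)
    (hz : y z ≤ r) (hs : s ∉ sublevelComp P y z r) :
    ∃ (k : ℕ) (S : Fin (k + 1) → Finset V), IsBottleneckSeq P π θ S ∧
      S 0 = sublevelComp P y z r ∧
      ∑ u ∈ (sublevelComp P y z r)ᶜ, π u * (y u - r) ≤
        1 / (1 - θ) * ∑ j, 1 / conductance P π (S j) := by
  induction hn : (sublevelComp P y z r)ᶜ.card using Nat.strong_induction_on generalizing r with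
  | _ n ih =>
    set B := sublevelComp P y z r with hB
    set q := flow P π Bᶜ B with hq
    have hzB : z ∈ B := self_mem_sublevelComp
    have hq0 : 0 < q := flow_compl_pos hP hS hzB hs
    have hπB : 0 < ∑ b ∈ B, π b :=
      Finset.sum_pos (fun b _ => hP.stationary_pos hS b) ⟨z, hzB⟩
    have hθ' : 0 < 1 - θ := by linarith
    obtain ⟨r', hr'⟩ : ∃ r', r' = r + (∑ b ∈ B, π b) / ((1 - θ) * q) := ⟨_, rfl⟩
    have hrr : r < r' := by rw [hr']; linarith [div_pos hπB (mul_pos hθ' hq0)]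
    have hflow := hy.flow_step hP hS hθ1 hz hs hr'
    rw [← hB, ← hq] at hflow
    set B' := sublevelComp P y z r' with hB'
    have hBB : B ⊆ B' := sublevelComp_mono hrr.le
    have hne : B ≠ B' := by
      intro h
      rw [← h, Finset.sdiff_self, flow, Finset.sum_empty] at hflow
      linarith [mul_pos hθ0 hq0]
    have hss : B ⊂ B' := hBB.ssubset_of_ne hne
    -- The choice of `r'` makes this rise, weighted by `π(Bᶜ)`, the contribution of `B` to the final
    -- sum.
    have hlevel : (r' - r) * ∑ u ∈ Bᶜ, π u = 1 / (1 - θ) * (1 / conductance P π B) := by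
      rw [conductance, ← flow_compl_comm hP.stochastic hS, ← hq, hr']
      field_simp
      ring
    have hup := hy.exists_adj_lt hP hS
    have hconn : ((chainGraph P).induce (B : Set V)).Connected := sublevelComp_connected
    have hcompl : ((chainGraph P).induce ((B : Set V)ᶜ)).Connected :=
      sublevelComp_compl_connected hz hup hs
    have hz' : y z ≤ r' := hz.trans hrr.le
    have hBne : B ≠ ∅ := Finset.ne_empty_of_mem hzB
    by_cases hs' : s ∈ B'
    -- The maximum of `y` is at `s`, so once `s` is absorbed the level `r'` dominates `y` and the
    -- sequence ends with `B`.
    · have hall : ∀ u, y u ≤ r' := by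
        obtain ⟨m, -, hm⟩ := Finset.exists_max_image Finset.univ y ⟨s, Finset.mem_univ s⟩
        have hms : m = s := by
          by_contra hne
          obtain ⟨w, -, hw⟩ := hup m hne
          linarith [hm w (Finset.mem_univ w)]
        intro u
        exact (hm u (Finset.mem_univ u)).trans (hms ▸ le_of_mem_sublevelComp hz' hs')
      refine ⟨0, fun _ => B, ?_, rfl, ?_⟩
      · exact
          { strictMono := fun i j hij => absurd hij (by omega)
            first_ne := hBne
            last_ne := fun h => hs (h ▸ Finset.mem_univ s)
            connected := fun _ => hconn
            compl_connected := fun _ => hcompl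
            flow_le := fun j => j.elim0 }
      · rw [show ∑ _j : Fin (0 + 1), 1 / conductance P π B = 1 / conductance P π B from
          Fin.sum_univ_one _, ← hlevel, Finset.mul_sum]
        refine Finset.sum_le_sum fun u _ => ?_
        rw [mul_comm]
        exact mul_le_mul_of_nonneg_right (by linarith [hall u]) (hS.nonneg u)
    · have hcard : B'ᶜ.card < n := by
        rw [← hn]
        exact Finset.card_lt_card (Finset.compl_ssubset_compl.2 hss)
      obtain ⟨k, S, hseq, hS0, hsum⟩ := ih _ hcard r' hz' hs' rfl
      refine ⟨k + 1, Matrix.vecCons B S, ?_, rfl, ?_⟩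
      · exact
          { strictMono := strictMono_vecCons.2 ⟨by rw [hS0]; exact hss, hseq.strictMono⟩
            first_ne := hBne
            last_ne := hseq.last_ne
            connected := Fin.cases hconn hseq.connected
            compl_connected := Fin.cases hcompl hseq.compl_connected
            flow_le := Fin.cases
              (by
                change θ * flow P π Bᶜ B ≤ flow P π (S 0 \ B) B
                rw [hS0]; exact hflow)
              hseq.flow_le }
      · rw [Fin.sum_univ_succ, mul_add]
        -- Vertices of `B' \ B` have `y ≤ r'`, so dropping them can only increase the sum.
        have h1 : ∑ u ∈ Bᶜ, π u * (y u - r') ≤ ∑ u ∈ B'ᶜ, π u * (y u - r') := by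
          rw [← Finset.sum_sdiff (Finset.compl_subset_compl.2 hBB)]
          refine add_le_of_nonpos_left (Finset.sum_nonpos fun u hu => ?_)
          have huB' : u ∈ B' := by simpa using (Finset.mem_sdiff.1 hu).2
          exact mul_nonpos_of_nonneg_of_nonpos (hS.nonneg u)
            (by linarith [le_of_mem_sublevelComp hz' huB'])
        have h2 : ∑ u ∈ Bᶜ, π u * (y u - r) =
            ∑ u ∈ Bᶜ, π u * (y u - r') + (r' - r) * ∑ u ∈ Bᶜ, π u := by
          rw [Finset.mul_sum, ← Finset.sum_add_distrib]
          exact Finset.sum_congr rfl fun u _ => by ring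
        rw [h2, hlevel]
        simp only [Matrix.cons_val_zero, Matrix.cons_val_succ]
        linarith

/-! ### The recursion applied to the filling rule -/

lemma one_sub_le_sum_exitFreq (hP : IsLazyIrreducible P) (hS : IsStationary P π) (s : V) :
    1 - π s ≤ ∑ u, exitFreq P π s u := by
  have h0 : 1 - π s ≤ moving P π s 0 := by
    refine le_trans ?_ (Finset.single_le_sum (f := fun u => exitMass P π s 0 u)
      (fun u _ => exitMass_nonneg s 0 u) (Finset.mem_univ s))
    simp [exitMass, filled_zero, present_zero]
  refine h0.trans ?_
  have := (hasSum_moving hP hS s).summable.le_tsum 0 fun n _ => moving_nonneg s n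
  rwa [(hasSum_moving hP hS s).tsum_eq] at this

lemma IsLazyIrreducible.nontrivial (hP : IsLazyIrreducible P) (s : V) : ∃ u, u ≠ s := by
  by_contra! h
  have h1 := sum_row_of_mem_rowStochastic hP.stochastic s
  have h2 : ∑ j, P s j = P s s := by
    refine Finset.sum_eq_single s (fun b _ hb => absurd (h b) hb) (by simp)
  rw [h2, hP.lazy] at h1
  norm_num at h1

lemma exists_mem_bottleneckSums (hP : IsLazyIrreducible P) (hS : IsStationary P π) {θ : ℝ}
    (hθ0 : 0 < θ) (hθ1 : θ < 1) (s : V) :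
    ∃ x ∈ bottleneckSums P π θ, ∑ u, exitFreq P π s u ≤ 1 / (1 - θ) * x := by
  obtain ⟨z, hz⟩ := exists_exitFreq_eq_zero hP hS s
  have hpos := hP.stationary_pos hS
  set y : V → ℝ := fun u => exitFreq P π s u / π u with hy
  have hπy : ∀ u, π u * y u = exitFreq P π s u := fun u => mul_div_cancel₀ _ (hpos u).ne'
  have hy0 : ∀ u, 0 ≤ y u := fun u => div_nonneg (exitFreq_nonneg s u) (hpos u).le
  have hdens : IsExitDensity P π s y := fun u => by
    simp_rw [hπy]; exact exitFreq_conservation hP hS s u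
  have hyz : y z ≤ 0 := by simp [hy, hz]
  -- The maximum of `y ≥ 0` is at `s`, and another vertex has a neighbour of strictly larger value,
  -- so `y s > 0`.
  have hs : s ∉ sublevelComp P y z 0 := by
    intro h
    have hs0 : y s ≤ 0 := le_of_mem_sublevelComp hyz h
    obtain ⟨u, hu⟩ := hP.nontrivial s
    obtain ⟨m, -, hm⟩ := Finset.exists_max_image Finset.univ y ⟨s, Finset.mem_univ s⟩
    have hms : m = s := by
      by_contra hne
      obtain ⟨w, -, hw⟩ := hdens.exists_adj_lt hP hS m hne
      linarith [hm w (Finset.mem_univ w)]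
    obtain ⟨w, -, hw⟩ := hdens.exists_adj_lt hP hS u hu
    linarith [hm w (Finset.mem_univ w), hy0 u, hms ▸ hs0]
  obtain ⟨k, S, hseq, -, hsum⟩ := hdens.exists_bottleneckSeq hP hS hθ0 hθ1 0 hyz hs
  refine ⟨_, ⟨k, S, hseq, rfl⟩, le_trans (le_of_eq ?_) hsum⟩
  rw [← Finset.sum_compl_add_sum (sublevelComp P y z 0)]
  rw [Finset.sum_eq_zero (s := sublevelComp P y z 0), add_zero]
  · exact Finset.sum_congr rfl fun u _ => by rw [sub_zero, hπy]
  · intro u hu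
    rw [← hπy, le_antisymm (le_of_mem_sublevelComp hyz hu) (hy0 u), mul_zero]

/-- A strictly increasing sequence of subsets has bounded length, so the maximum exists. -/
lemma finite_bottleneckSums (P : Matrix V V ℝ) (π : V → ℝ) (θ : ℝ) :
    (bottleneckSums P π θ).Finite := by
  refine (Set.finite_range fun p : Σ k : Fin (Fintype.card (Finset V)), (Fin (k + 1) → Finset V) =>
    ∑ j, 1 / conductance P π (p.2 j)).subset ?_
  rintro x ⟨k, S, hS, rfl⟩
  have hk := Fintype.card_le_of_injective S hS.strictMono.injective
  rw [Fintype.card_fin] at hk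
  exact ⟨⟨⟨k, hk⟩, S⟩, rfl⟩

end Flow

section Energy

variable {V : Type*} [Fintype V]

/-! ### Smoothing by a lazy reversible chain -/

/-- The inner product of `L²(π)`. -/
def wInner (π f g : V → ℝ) : ℝ := ∑ u, π u * (f u * g u)

variable {P : Matrix V V ℝ} {π : V → ℝ}

lemma wInner_comm (f g : V → ℝ) : wInner π f g = wInner π g f :=
  Finset.sum_congr rfl fun u _ => by rw [mul_comm (f u)]

lemma wInner_sub_left (f g h : V → ℝ) : wInner π (f - g) h = wInner π f h - wInner π g h := by
  rw [wInner, wInner, wInner, ← Finset.sum_sub_distrib]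
  exact Finset.sum_congr rfl fun u _ => by rw [Pi.sub_apply]; ring

lemma wInner_sub_right (f g h : V → ℝ) : wInner π f (g - h) = wInner π f g - wInner π f h := by
  rw [wInner_comm, wInner_sub_left, wInner_comm, wInner_comm h]

lemma wInner_self_nonneg (hπ : ∀ v, 0 ≤ π v) (f : V → ℝ) : 0 ≤ wInner π f f :=
  Finset.sum_nonneg fun u _ => mul_nonneg (hπ u) (mul_self_nonneg _)

lemma wInner_mulVec_comm (hR : IsReversible P π) (f g : V → ℝ) :
    wInner π (P *ᵥ f) g = wInner π f (P *ᵥ g) := by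
  simp_rw [wInner, mulVec, dotProduct, Finset.sum_mul, Finset.mul_sum]
  rw [Finset.sum_comm]
  refine Finset.sum_congr rfl fun u _ => Finset.sum_congr rfl fun v _ => ?_
  linear_combination (f u * g v) * hR v u

lemma sum_stationary_sq_right (hS : IsStationary P π) (f : V → ℝ) :
    ∑ u, ∑ v, π u * P u v * (f v * f v) = wInner π f f := by
  rw [Finset.sum_comm]
  refine Finset.sum_congr rfl fun v _ => ?_
  rw [← Finset.sum_mul, hS.invariant]

lemma sum_stationary_mul (f : V → ℝ) :
    ∑ u, ∑ v, π u * P u v * (f u * f v) = wInner π f (P *ᵥ f) := by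
  refine Finset.sum_congr rfl fun u _ => ?_
  simp_rw [mulVec, dotProduct, Finset.mul_sum]
  exact Finset.sum_congr rfl fun v _ => by ring

variable [DecidableEq V]

lemma sum_stationary_sq_left (hP : P ∈ rowStochastic ℝ V) (f : V → ℝ) :
    ∑ u, ∑ v, π u * P u v * (f u * f u) = wInner π f f := by
  refine Finset.sum_congr rfl fun u _ => ?_
  rw [← Finset.sum_mul, ← Finset.mul_sum, sum_row_of_mem_rowStochastic hP, mul_one]

lemma wInner_mulVec_le (hP : P ∈ rowStochastic ℝ V) (hS : IsStationary P π) (f : V → ℝ) :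
    wInner π f (P *ᵥ f) ≤ wInner π f f := by
  have h : 0 ≤ ∑ u, ∑ v, π u * P u v * (f u - f v) ^ 2 :=
    Finset.sum_nonneg fun u _ => Finset.sum_nonneg fun v _ =>
      mul_nonneg (mul_nonneg (hS.nonneg u) (nonneg_of_mem_rowStochastic hP)) (sq_nonneg _)
  have e : ∑ u, ∑ v, π u * P u v * (f u - f v) ^ 2 =
      ∑ u, ∑ v, π u * P u v * (f u * f u) + ∑ u, ∑ v, π u * P u v * (f v * f v) -
        2 * ∑ u, ∑ v, π u * P u v * (f u * f v) := by
    simp_rw [Finset.mul_sum, ← Finset.sum_add_distrib, ← Finset.sum_sub_distrib]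
    exact Finset.sum_congr rfl fun u _ => Finset.sum_congr rfl fun v _ => by ring
  rw [e, sum_stationary_sq_left hP, sum_stationary_sq_right hS, sum_stationary_mul] at h
  linarith

/-- In `∑ π P (f u + f v)²`, which equals `2⟨f, f⟩ + 2⟨f, P f⟩`, the diagonal terms alone give `2⟨f,
f⟩`, because the holding probability is `1/2`. -/
lemma wInner_mulVec_nonneg (hP : IsLazyIrreducible P) (hS : IsStationary P π) (f : V → ℝ) :
    0 ≤ wInner π f (P *ᵥ f) := by
  have h : ∑ u, π u * P u u * (f u + f u) ^ 2 ≤ ∑ u, ∑ v, π u * P u v * (f u + f v) ^ 2 :=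
    Finset.sum_le_sum fun u _ =>
      Finset.single_le_sum (f := fun v => π u * P u v * (f u + f v) ^ 2)
        (fun v _ => mul_nonneg (mul_nonneg (hS.nonneg u)
          (nonneg_of_mem_rowStochastic hP.stochastic)) (sq_nonneg _)) (Finset.mem_univ u)
  have e : ∑ u, ∑ v, π u * P u v * (f u + f v) ^ 2 =
      ∑ u, ∑ v, π u * P u v * (f u * f u) + ∑ u, ∑ v, π u * P u v * (f v * f v) +
        2 * ∑ u, ∑ v, π u * P u v * (f u * f v) := by
    simp_rw [Finset.mul_sum, ← Finset.sum_add_distrib]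
    exact Finset.sum_congr rfl fun u _ => Finset.sum_congr rfl fun v _ => by ring
  have d : ∑ u, π u * P u u * (f u + f u) ^ 2 = 2 * wInner π f f := by
    rw [wInner, Finset.mul_sum]
    exact Finset.sum_congr rfl fun u _ => by rw [hP.lazy]; ring
  rw [e, d, sum_stationary_sq_left hP.stochastic, sum_stationary_sq_right hS,
    sum_stationary_mul] at h
  linarith

lemma pow_succ_mulVec (n : ℕ) (f : V → ℝ) : (P ^ (n + 1)) *ᵥ f = P *ᵥ ((P ^ n) *ᵥ f) := by
  rw [pow_succ', Matrix.mulVec_mulVec]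

lemma wInner_pow_mulVec (hR : IsReversible P π) (m n : ℕ) (f g : V → ℝ) :
    wInner π ((P ^ m) *ᵥ f) ((P ^ n) *ᵥ g) = wInner π f ((P ^ (m + n)) *ᵥ g) := by
  induction m generalizing n with
  | zero => simp
  | succ m ih =>
    rw [pow_succ_mulVec, wInner_mulVec_comm hR, ← pow_succ_mulVec, ih]
    congr 3
    ring

/-- `⟨f, Pⁿ f⟩`, which is completely monotone in `n` for a lazy reversible chain. -/
def moment (P : Matrix V V ℝ) (π f : V → ℝ) (n : ℕ) : ℝ := wInner π f ((P ^ n) *ᵥ f)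

/-- The claim is `⟨f, Pⁿ (1 - P)³ f⟩ ≥ 0`. For even `n` it is the positivity of `1 - P` at `P^k (1 -
P) f`. For odd `n` write `P (1 - P)³ = P² (1 - P)³ + P (1 - P)⁴` and use the positivity of `1 - P`
and of `P`, thus avoiding the spectral theorem. -/
lemma moment_second_diff_antitone (hP : IsLazyIrreducible P) (hS : IsStationary P π)
    (hR : IsReversible P π) (f : V → ℝ) :
    Antitone fun n => moment P π f n - 2 * moment P π f (n + 1) + moment P π f (n + 2) := by
  refine antitone_nat_of_succ_le fun n => ?_
  have hB : ∀ i j, wInner π ((P ^ i) *ᵥ f) ((P ^ j) *ᵥ f) = moment P π f (i + j) :=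
    fun i j => wInner_pow_mulVec hR i j f f
  rcases Nat.even_or_odd' n with ⟨k, rfl | rfl⟩
  · have h := wInner_mulVec_le hP.stochastic hS ((P ^ k) *ᵥ f - (P ^ (k + 1)) *ᵥ f)
    rw [mulVec_sub, ← pow_succ_mulVec, ← pow_succ_mulVec] at h
    simp only [wInner_sub_left, wInner_sub_right, hB] at h
    ring_nf at h ⊢
    linarith
  · have h1 := wInner_mulVec_le hP.stochastic hS ((P ^ (k + 1)) *ᵥ f - (P ^ (k + 2)) *ᵥ f)
    have h2 := wInner_mulVec_nonneg hP hS
      ((P ^ k) *ᵥ f - (P ^ (k + 1)) *ᵥ f - ((P ^ (k + 1)) *ᵥ f - (P ^ (k + 2)) *ᵥ f))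
    simp only [mulVec_sub, ← pow_succ_mulVec] at h1 h2
    simp only [wInner_sub_left, wInner_sub_right, hB] at h1 h2
    ring_nf at h1 h2 ⊢
    linarith

lemma moment_second_diff_nonneg (hP : IsLazyIrreducible P) (hS : IsStationary P π)
    (hR : IsReversible P π) (f : V → ℝ) (n : ℕ) :
    0 ≤ moment P π f n - 2 * moment P π f (n + 1) + moment P π f (n + 2) := by
  refine le_trans ?_ (moment_second_diff_antitone hP hS hR f (show n ≤ 2 * n by omega))
  have h := wInner_self_nonneg hS.nonneg ((P ^ n) *ᵥ f - (P ^ (n + 1)) *ᵥ f)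
  simp only [wInner_sub_left, wInner_sub_right, wInner_pow_mulVec hR] at h
  simp only [moment]
  ring_nf at h ⊢
  linarith

lemma moment_nonneg (hP : IsLazyIrreducible P) (hS : IsStationary P π)
    (hR : IsReversible P π) (f : V → ℝ) (n : ℕ) : 0 ≤ moment P π f n := by
  rcases Nat.even_or_odd' n with ⟨k, rfl | rfl⟩
  · have h := wInner_self_nonneg hS.nonneg ((P ^ k) *ᵥ f)
    rw [wInner_pow_mulVec hR] at h
    rwa [moment, two_mul]
  · have h := wInner_mulVec_nonneg hP hS ((P ^ k) *ᵥ f)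
    rw [← pow_succ_mulVec, wInner_pow_mulVec hR] at h
    rwa [moment, two_mul, add_assoc]

lemma moment_diff_nonneg (hP : IsLazyIrreducible P) (hS : IsStationary P π)
    (hR : IsReversible P π) (f : V → ℝ) (n : ℕ) :
    0 ≤ moment P π f n - moment P π f (n + 1) := by
  rcases Nat.even_or_odd' n with ⟨k, rfl | rfl⟩
  · have h := wInner_mulVec_le hP.stochastic hS ((P ^ k) *ᵥ f)
    rw [← pow_succ_mulVec, wInner_pow_mulVec hR, wInner_pow_mulVec hR] at h
    simp only [moment]
    ring_nf at h ⊢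
    linarith
  · have h1 := wInner_mulVec_le hP.stochastic hS ((P ^ (k + 1)) *ᵥ f)
    have h2 := wInner_mulVec_nonneg hP hS ((P ^ k) *ᵥ f - (P ^ (k + 1)) *ᵥ f)
    simp only [mulVec_sub, ← pow_succ_mulVec] at h1 h2
    simp only [wInner_sub_left, wInner_sub_right, wInner_pow_mulVec hR] at h1 h2
    simp only [moment]
    ring_nf at h1 h2 ⊢
    linarith

/-- If `a` is antitone and nonnegative then `(n + 1) a (2 n) ≤ a n + ⋯ + a (2 n)`. -/
lemma succ_mul_le_sum {a : ℕ → ℝ} (ha : Antitone a) (n : ℕ) :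
    (n + 1) * a (2 * n) ≤ ∑ i ∈ Finset.range (n + 1), a (n + i) := by
  have h := Finset.card_nsmul_le_sum (Finset.range (n + 1)) (fun i => a (n + i)) (a (2 * n))
    fun i hi => ha (by have := Finset.mem_range.1 hi; omega)
  simpa [nsmul_eq_mul] using h

/-- `‖Pⁿ⁺¹ f - Pⁿ f‖ ≤ ‖f‖ / (n + 1)` in `L²(π)` for a lazy reversible chain. -/
lemma wInner_pow_sub_le (hP : IsLazyIrreducible P) (hS : IsStationary P π)
    (hR : IsReversible P π) (f : V → ℝ) (n : ℕ) :
    (n + 1) ^ 2 * wInner π ((P ^ (n + 1)) *ᵥ f - (P ^ n) *ᵥ f)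
      ((P ^ (n + 1)) *ᵥ f - (P ^ n) *ᵥ f) ≤ wInner π f f := by
  set a := moment P π f with ha
  -- The squared norm is the second difference of the moments at `2 n`. Two uses of monotonicity,
  -- for second and then first differences, each gain a factor `n + 1`.
  have hsq : wInner π ((P ^ (n + 1)) *ᵥ f - (P ^ n) *ᵥ f)
      ((P ^ (n + 1)) *ᵥ f - (P ^ n) *ᵥ f) = a (2 * n) - 2 * a (2 * n + 1) + a (2 * n + 2) := by
    simp only [wInner_sub_left, wInner_sub_right, wInner_pow_mulVec hR, ha, moment]
    ring_nf
  have hb : Antitone fun n => a n - a (n + 1) := antitone_nat_of_succ_le fun n => by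
    linarith [moment_second_diff_nonneg hP hS hR f n]
  have h1 := succ_mul_le_sum (moment_second_diff_antitone hP hS hR f) n
  have h2 : ∑ i ∈ Finset.range (n + 1),
      (a (n + i) - 2 * a (n + i + 1) + a (n + i + 2)) ≤ a n - a (n + 1) := by
    have e : ∀ i, a (n + i) - 2 * a (n + i + 1) + a (n + i + 2) =
        (fun i => a (n + i) - a (n + i + 1)) i - (fun i => a (n + i) - a (n + i + 1)) (i + 1) := by
      intro i
      simp only
      rw [show n + (i + 1) = n + i + 1 by ring]; ring
    simp_rw [e]
    rw [Finset.sum_range_sub']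
    have := moment_diff_nonneg hP hS hR f (n + (n + 1))
    simp only [add_zero]
    linarith
  have h3 : (n + 1) * (a n - a (n + 1)) ≤ a 0 := by
    have h := Finset.card_nsmul_le_sum (Finset.range (n + 1)) (fun i => a i - a (i + 1))
      (a n - a (n + 1)) fun i hi => hb (by have := Finset.mem_range.1 hi; omega)
    rw [Finset.sum_range_sub', Finset.card_range, nsmul_eq_mul] at h
    push_cast at h
    linarith [moment_nonneg hP hS hR f (n + 1)]
  have h4 : a 0 = wInner π f f := by simp [ha, moment]
  rw [hsq, ← h4, sq, mul_assoc]
  refine le_trans (mul_le_mul_of_nonneg_left (h1.trans h2) (by positivity)) h3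

end Energy

section Mixing

variable {V : Type*} [Fintype V] {P : Matrix V V ℝ} {π : V → ℝ}

/-! ### From stopping times to mixing times -/

lemma sq_sum_mul_abs_le (hS : IsStationary P π) (h : V → ℝ) :
    (∑ u, π u * |h u|) ^ 2 ≤ wInner π h h := by
  have e : ∀ m : ℝ, ∑ u, π u * (|h u| - m) ^ 2 =
      wInner π h h - 2 * m * ∑ u, π u * |h u| + m ^ 2 * ∑ u, π u := by
    intro m
    rw [wInner, Finset.mul_sum, Finset.mul_sum, ← Finset.sum_sub_distrib, ← Finset.sum_add_distrib]
    refine Finset.sum_congr rfl fun u _ => ?_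
    rw [← abs_mul_abs_self (h u)]; ring
  have h0 : 0 ≤ ∑ u, π u * (|h u| - ∑ v, π v * |h v|) ^ 2 :=
    Finset.sum_nonneg fun u _ => mul_nonneg (hS.nonneg u) (sq_nonneg _)
  rw [e, hS.sum_eq_one] at h0
  linarith

variable [DecidableEq V]

lemma pow_succ_mulVec_apply (n : ℕ) (f : V → ℝ) (u : V) :
    ((P ^ (n + 1)) *ᵥ f) u = ∑ w, P u w * ((P ^ n) *ᵥ f) w := by
  rw [pow_succ_mulVec]; rfl

lemma abs_pow_mulVec_le (hP : P ∈ rowStochastic ℝ V) {f : V → ℝ} (hf : ∀ u, |f u| ≤ 1) (n : ℕ)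
    (u : V) : |((P ^ n) *ᵥ f) u| ≤ 1 := by
  rw [← sum_row_of_mem_rowStochastic (pow_mem hP n) u]
  refine (Finset.abs_sum_le_sum_abs _ _).trans (Finset.sum_le_sum fun w _ => ?_)
  rw [abs_mul, abs_of_nonneg (pow_nonneg_apply hP n u w)]
  exact mul_le_of_le_one_right (pow_nonneg_apply hP n u w) (hf w)

lemma sum_stationary_pow_mulVec (hS : IsStationary P π) (f : V → ℝ) (n : ℕ) :
    ∑ u, π u * ((P ^ n) *ᵥ f) u = ∑ u, π u * f u := by
  induction n with
  | zero => simp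
  | succ n ih =>
    rw [← ih]
    simp_rw [pow_succ_mulVec_apply, Finset.mul_sum]
    rw [Finset.sum_comm]
    refine Finset.sum_congr rfl fun v _ => ?_
    simp_rw [← mul_assoc]
    rw [← Finset.sum_mul, hS.invariant]

/-- The strong Markov property for the filling rule. -/
lemma pow_mulVec_eq_sum_stopMass (s : V) (f : V → ℝ) (n j : ℕ) :
    ((P ^ (n + j)) *ᵥ f) s =
      ∑ k ∈ Finset.range n, ∑ u, stopMass P π s k u * ((P ^ (n + j - k)) *ᵥ f) u +
        ∑ u, present P π s n u * ((P ^ j) *ᵥ f) u := by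
  induction n generalizing j with
  | zero => simp [present_zero]
  | succ n ih =>
    have hlast : ∑ u, present P π s n u * ((P ^ (j + 1)) *ᵥ f) u =
        ∑ u, stopMass P π s n u * ((P ^ (j + 1)) *ᵥ f) u +
          ∑ u, present P π s (n + 1) u * ((P ^ j) *ᵥ f) u := by
      have h1 : ∑ u, present P π s (n + 1) u * ((P ^ j) *ᵥ f) u =
          ∑ u, exitMass P π s n u * ((P ^ (j + 1)) *ᵥ f) u := by
        simp_rw [present_succ, pow_succ_mulVec_apply, Finset.sum_mul, Finset.mul_sum]
        rw [Finset.sum_comm]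
        simp_rw [mul_assoc]
      rw [h1, ← Finset.sum_add_distrib]
      exact Finset.sum_congr rfl fun u _ => by rw [stopMass]; ring
    rw [show n + 1 + j = n + (j + 1) by ring, ih, hlast, Finset.sum_range_succ,
      show n + (j + 1) - n = j + 1 by omega, add_assoc]

/-- Markov's inequality for the stopping time, in tail-sum form. -/
lemma succ_mul_moving_le (hP : IsLazyIrreducible P) (hS : IsStationary P π) (s : V) (n : ℕ) :
    (n + 1) * moving P π s n ≤ ∑ u, exitFreq P π s u := by
  have h := Finset.card_nsmul_le_sum (Finset.range (n + 1)) (moving P π s) (moving P π s n)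
    fun i hi => moving_antitone hP.stochastic hS.nonneg s
      (by have := Finset.mem_range.1 hi; omega)
  rw [Finset.card_range, nsmul_eq_mul] at h
  push_cast at h
  refine h.trans ?_
  rw [← (hasSum_moving hP hS s).tsum_eq]
  exact (hasSum_moving hP hS s).summable.sum_le_tsum _ fun n _ => moving_nonneg s n

lemma sum_mul_abs_pow_sub_le (hP : IsLazyIrreducible P) (hS : IsStationary P π)
    (hR : IsReversible P π) {f : V → ℝ} (hf : ∀ u, |f u| ≤ 1) (n : ℕ) :
    ∑ u, π u * |((P ^ (n + 1)) *ᵥ f) u - ((P ^ n) *ᵥ f) u| ≤ 1 / (n + 1) := by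
  have hn : (0 : ℝ) < n + 1 := by positivity
  have h1 := sq_sum_mul_abs_le hS ((P ^ (n + 1)) *ᵥ f - (P ^ n) *ᵥ f)
  have h2 := wInner_pow_sub_le hP hS hR f n
  have h3 : wInner π f f ≤ 1 := by
    rw [← hS.sum_eq_one]
    refine Finset.sum_le_sum fun u _ => mul_le_of_le_one_right (hS.nonneg u) ?_
    rw [← abs_mul_abs_self]
    exact mul_le_one₀ (hf u) (abs_nonneg _) (hf u)
  have h4 := (mul_le_mul_of_nonneg_left h1 (sq_nonneg ((n : ℝ) + 1))).trans (h2.trans h3)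
  rw [← mul_pow] at h4
  rw [le_div_iff₀ hn, mul_comm]
  exact (sq_le_one_iff₀ (mul_nonneg hn.le (Finset.sum_nonneg fun u _ =>
    mul_nonneg (hS.nonneg u) (abs_nonneg _)))).1 h4

/-- Comparison of the law at the fixed time `L + 1 + N` with the stationary law, through the filling
rule and the smoothing estimate. -/
lemma abs_pow_mulVec_le_of_sum_eq_zero (hP : IsLazyIrreducible P) (hS : IsStationary P π)
    (hR : IsReversible P π) {f : V → ℝ} (hf : ∀ u, |f u| ≤ 1) (hf0 : ∑ u, π u * f u = 0)
    (s : V) (L N : ℕ) :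
    |((P ^ (L + 1 + N)) *ᵥ f) s| ≤ (L + 1) / (N + 1) + 2 * moving P π s L := by
  set F : ℕ → V → ℝ := fun n => (P ^ n) *ᵥ f with hF
  have hF1 : ∀ n u, |F n u| ≤ 1 := abs_pow_mulVec_le hP.stochastic hf
  -- The variation of `F` in time over the window from `N` to `N + L + 1` controls all stopping
  -- times up to `L` at once.
  set D : V → ℝ := fun u => ∑ i ∈ Finset.range (L + 1), |F (N + i + 1) u - F (N + i) u| with hD
  have hwin : ∀ m ≤ L + 1, ∀ u, |F (N + m) u - F N u| ≤ D u := by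
    intro m hm u
    have e : F (N + m) u - F N u =
        ∑ i ∈ Finset.range m, (F (N + i + 1) u - F (N + i) u) :=
      (Finset.sum_range_sub (fun i => F (N + i) u) m).symm
    rw [e]
    exact (Finset.abs_sum_le_sum_abs _ _).trans <|
      Finset.sum_le_sum_of_subset_of_nonneg (Finset.range_mono hm) fun _ _ _ => abs_nonneg _
  have hDsum : ∑ u, π u * D u ≤ (L + 1) / (N + 1) := by
    simp_rw [hD, Finset.mul_sum]
    rw [Finset.sum_comm]
    calc _ ≤ ∑ _i ∈ Finset.range (L + 1), 1 / ((N : ℝ) + 1) := by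
          refine Finset.sum_le_sum fun i _ =>
            (sum_mul_abs_pow_sub_le hP hS hR hf (N + i)).trans ?_
          refine one_div_le_one_div_of_le (by positivity) ?_
          push_cast
          linarith [Nat.cast_nonneg (α := ℝ) i]
      _ = _ := by
          rw [Finset.sum_const, Finset.card_range, nsmul_eq_mul]
          push_cast; ring
  have hmass_nonneg : ∀ k u, 0 ≤ stopMass P π s k u := stopMass_nonneg hP.stochastic hS.nonneg s
  -- Replace the time remaining after each stop by `N`. If the stopped law were exactly `π`, the
  -- result would be zero; the deficit from `π` and the mass still moving each cost at most `moving
  -- L`.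
  have hdecomp : F (L + 1 + N) s =
      ∑ k ∈ Finset.range (L + 1), ∑ u, stopMass P π s k u * (F (L + 1 + N - k) u - F N u) -
        ∑ u, (π u - filled P π s (L + 1) u) * F N u + ∑ u, present P π s (L + 1) u * F N u := by
    have h1 : ∑ k ∈ Finset.range (L + 1), ∑ u, stopMass P π s k u * F N u =
        ∑ u, filled P π s (L + 1) u * F N u := by
      rw [Finset.sum_comm]
      simp_rw [filled_eq_sum, Finset.sum_mul]
    have h2 : ∑ u, π u * F N u = 0 := (sum_stationary_pow_mulVec hS f N).trans hf0
    simp_rw [sub_mul, mul_sub, Finset.sum_sub_distrib]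
    rw [h1, h2, hF]
    simp only
    rw [pow_mulVec_eq_sum_stopMass (π := π) s f (L + 1) N]
    ring
  have hA : |∑ k ∈ Finset.range (L + 1),
      ∑ u, stopMass P π s k u * (F (L + 1 + N - k) u - F N u)| ≤ ∑ u, π u * D u := by
    calc _ ≤ ∑ k ∈ Finset.range (L + 1), ∑ u, stopMass P π s k u * D u := by
          refine (Finset.abs_sum_le_sum_abs _ _).trans (Finset.sum_le_sum fun k hk => ?_)
          refine (Finset.abs_sum_le_sum_abs _ _).trans (Finset.sum_le_sum fun u _ => ?_)
          rw [abs_mul, abs_of_nonneg (hmass_nonneg k u)]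
          refine mul_le_mul_of_nonneg_left ?_ (hmass_nonneg k u)
          have hk' := Finset.mem_range.1 hk
          rw [show L + 1 + N - k = N + (L + 1 - k) by omega]
          exact hwin _ (by omega) u
      _ = ∑ u, filled P π s (L + 1) u * D u := by
          rw [Finset.sum_comm]
          simp_rw [filled_eq_sum, Finset.sum_mul]
      -- Domination of the stopped mass by `π` turns a pointwise error into an `L¹(π)` error, which
      -- the smoothing estimate bounds.
      _ ≤ _ := Finset.sum_le_sum fun u _ =>
          mul_le_mul_of_nonneg_right (filled_le hS.nonneg s _ u)
            (Finset.sum_nonneg fun _ _ => abs_nonneg _)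
  have hweight : ∀ g : V → ℝ, (∀ u, 0 ≤ g u) → |∑ u, g u * F N u| ≤ ∑ u, g u := by
    intro g hg
    refine (Finset.abs_sum_le_sum_abs _ _).trans (Finset.sum_le_sum fun u _ => ?_)
    rw [abs_mul, abs_of_nonneg (hg u)]
    exact mul_le_of_le_one_right (hg u) (hF1 N u)
  have hB := hweight (fun u => π u - filled P π s (L + 1) u)
    fun u => sub_nonneg.2 (filled_le hS.nonneg s _ u)
  have hC := hweight (present P π s (L + 1)) (present_nonneg hP.stochastic s _)
  rw [sum_present_succ hP.stochastic] at hC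
  rw [Finset.sum_sub_distrib, hS.sum_eq_one] at hB
  have hM := sum_filled_succ_add_moving (π := π) hP.stochastic s L
  change |F (L + 1 + N) s| ≤ _
  rw [hdecomp]
  refine (abs_add_le _ _).trans ?_
  have := abs_sub (∑ k ∈ Finset.range (L + 1),
      ∑ u, stopMass P π s k u * (F (L + 1 + N - k) u - F N u))
      (∑ u, (π u - filled P π s (L + 1) u) * F N u)
  linarith

lemma tvDist_pow_le (hP : IsLazyIrreducible P) (hS : IsStationary P π)
    (hR : IsReversible P π) (s : V) (L N : ℕ) :
    tvDist ((P ^ (L + 1 + N)) s) π ≤ (L + 1) / (N + 1) + 2 * moving P π s L := by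
  refine ciSup_le fun A => ?_
  set a := ∑ v ∈ A, π v with ha
  have ha0 : 0 ≤ a := Finset.sum_nonneg fun v _ => hS.nonneg v
  have ha1 : a ≤ 1 := by
    rw [← hS.sum_eq_one]
    exact Finset.sum_le_sum_of_subset_of_nonneg (Finset.subset_univ A) fun v _ _ => hS.nonneg v
  set f : V → ℝ := fun u => (if u ∈ A then 1 else 0) - a with hf
  have hf1 : ∀ u, |f u| ≤ 1 := by
    intro u
    rw [hf, abs_le]
    simp only
    split_ifs <;> constructor <;> linarith
  have hf0 : ∑ u, π u * f u = 0 := by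
    simp_rw [hf, mul_sub, Finset.sum_sub_distrib, ← Finset.sum_mul, hS.sum_eq_one]
    simp [ha]
  have hval : ((P ^ (L + 1 + N)) *ᵥ f) s = ∑ v ∈ A, (P ^ (L + 1 + N)) s v - a := by
    simp_rw [mulVec, dotProduct, hf, mul_sub, Finset.sum_sub_distrib, ← Finset.sum_mul,
      sum_row_of_mem_rowStochastic (pow_mem hP.stochastic (L + 1 + N))]
    simp
  rw [← hval]
  exact abs_pow_mulVec_le_of_sum_eq_zero hP hS hR hf1 hf0 s L N

lemma tMix_le (hP : IsLazyIrreducible P) (hS : IsStationary P π) (hR : IsReversible P π) {T : ℝ}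
    (hT : ∀ s, ∑ u, exitFreq P π s u ≤ T) (hT2 : 1 / 2 ≤ T) :
    tMix P π ≤ ENNReal.ofReal (162 * T) := by
  -- With `L + 1 = ⌈16 T⌉` and `N = 8 (L + 1)` the errors are at most `1/8` and `2 · 1/16`. The
  -- total time is `9 (L + 1) ≤ 144 T + 9 ≤ 162 T`, as `T ≥ 1/2`.
  obtain ⟨L, hL⟩ : ∃ L, ⌈16 * T⌉₊ = L + 1 :=
    Nat.exists_eq_succ_of_ne_zero (Nat.ceil_pos.2 (by linarith)).ne'
  have hL1 : 16 * T ≤ L + 1 := by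
    have := Nat.le_ceil (16 * T)
    rw [hL] at this
    exact_mod_cast this
  have hL2 : (L : ℝ) + 1 < 16 * T + 1 := by
    have := Nat.ceil_lt_add_one (show 0 ≤ 16 * T by linarith)
    rw [hL] at this
    exact_mod_cast this
  have htv : ∀ s, tvDist ((P ^ (L + 1 + 8 * (L + 1))) s) π ≤ 1 / 4 := by
    intro s
    refine (tvDist_pow_le hP hS hR s L (8 * (L + 1))).trans ?_
    have hpos : (0 : ℝ) < L + 1 := by positivity
    have h1 : ((L : ℝ) + 1) / ((8 * (L + 1) : ℕ) + 1) ≤ 1 / 8 := by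
      rw [div_le_div_iff₀ (by positivity) (by norm_num)]
      push_cast
      linarith
    have h2 : moving P π s L ≤ 1 / 16 := by
      refine le_of_mul_le_mul_left ?_ hpos
      linarith [succ_mul_moving_le hP hS s L, hT s]
    linarith
  refine (iInf₂_le (L + 1 + 8 * (L + 1)) htv).trans ?_
  rw [← ENNReal.ofReal_natCast]
  refine ENNReal.ofReal_le_ofReal ?_
  push_cast
  linarith

end Mixing

end BottleneckSeq

end

open BottleneckSeq in
theorem theorem2 (θ : ℝ) (hθ0 : 0 < θ) (hθ1 : θ < 1) :
    ∃ C : ℝ, 0 < C ∧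
      ∀ (V : Type*) [Fintype V] [DecidableEq V] (P : Matrix V V ℝ) (π : V → ℝ),
        IsLazyIrreducible P → IsStationary P π →
          ∃ M : ℝ, IsGreatest (bottleneckSums P π θ) M ∧
            tStop P π ≤ ENNReal.ofReal (1 / (1 - θ) * M) ∧
            (IsReversible P π → tMix P π ≤ ENNReal.ofReal (C * M)) := by
  have hθ' : 0 < 1 - θ := by linarith
  refine ⟨162 * (1 / (1 - θ)), by positivity, fun V _ _ P π hP hS => ?_⟩
  obtain ⟨s⟩ : Nonempty V := by
    by_contra h
    rw [not_nonempty_iff] at h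
    simpa using hS.sum_eq_one
  obtain ⟨x, hx, -⟩ := exists_mem_bottleneckSums hP hS hθ0 hθ1 s
  obtain ⟨M, hM, hmax⟩ := (finite_bottleneckSums P π θ).exists_maximal ⟨x, hx⟩
  have hgreat : IsGreatest (bottleneckSums P π θ) M :=
    ⟨hM, fun x hx => (le_total x M).elim id fun h => hmax hx h⟩
  have hT : ∀ v, ∑ u, exitFreq P π v u ≤ 1 / (1 - θ) * M := fun v => by
    obtain ⟨x, hx, hvx⟩ := exists_mem_bottleneckSums hP hS hθ0 hθ1 v
    exact hvx.trans (mul_le_mul_of_nonneg_left (hgreat.2 hx) (by positivity))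
  refine ⟨M, hgreat, tStop_le hP hS hT, fun hR => ?_⟩
  rw [mul_assoc]
  refine tMix_le hP hS hR hT ?_
  -- For two distinct vertices, `2 T ≥ (1 - π u) + (1 - π s) ≥ 1`.
  obtain ⟨u, hu⟩ := hP.nontrivial s
  have h1 : π u + π s ≤ 1 := by
    rw [← hS.sum_eq_one, ← Finset.sum_pair hu]
    exact Finset.sum_le_sum_of_subset_of_nonneg (Finset.subset_univ _) fun v _ _ => hS.nonneg v
  linarith [one_sub_le_sum_exitFreq hP hS u, one_sub_le_sum_exitFreq hP hS s, hT u, hT s]
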